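/- Let $m,n\ge 1$ be integers. For a positive integer $H$ let $\mathcal M_n(\mathbb Z;H)$ be the set of $n\times n$ integer matrices all of whose entries are at most $H$ in absolute value, and for an $n\times n$ integer matrix $C$ let $$\mathcal T_m(\mathcal M_n(\mathbb Z;H),C)=\{(A_1,\dots,A_m)\in\mathcal M_n(\mathbb Z;H)^m : A_1A_2\cdots A_m=C\}.$$ Then the following hold, uniformly in $C$. 1. For every $\varepsilon>0$ there is $H_0=H_0(m,n,\varepsilon)$ such that for all $H\ge H_0$ and all nonsingular $C$, $$\#\mathcal T_m(\mathcal M_n(\mathbb Z;H),C)\le H^{(m-1)(n^2-n)+\varepsilon}.$$ 2. If $m=2$, then for every $\varepsilon>0$ there is $H_0=H_0(n,\varepsilon)$ such that for all $H\ge H_0$ and all singular $C\ne O_n$, $$\#\mathcal T_2(\mathcal M_n(\mathbb Z;H),C)\le H^{n^2+\varepsilon}.$$ 3. If $m\ge 3$, then there is $H_0=H_0(m,n)$ such that for all $H\ge H_0$ and all singular $C\ne O_n$, $$\#\mathcal T_m(\mathcal M_n(\mathbb Z;H),C)\le H^{mn^2-n}.$$ 4. For the zero matrix $O_n$ there is a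 constant $c=c(m,n)>0$ with $$c\,H^{(m-1)n^2}\le \#\mathcal T_m(\mathcal M_n(\mathbb Z;H),O_n)\quad\text{for all } H\ge 1,$$ and for every $\varepsilon>0$ there is $H_0=H_0(m,n,\varepsilon)$ such that for all $H\ge H_0$, $$\#\mathcal T_m(\mathcal M_n(\mathbb Z;H),O_n)\le H^{(m-1)n^2+\varepsilon}.$$ -/

import Mathlib

/-- `M_n(ℤ; H)`: the set of `n × n` integer matrices with all entries at most `H` in
absolute value. -/
def boundedMatrices (n H : ℕ) : Set (Matrix (Fin n) (Fin n) ℤ) :=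
  {A | ∀ i j, |A i j| ≤ (H : ℤ)}

/-- `T_m(M, C)`: the set of `m`-tuples `(A_1, …, A_m)` of elements of `M` whose ordered product
`A_1 ⋯ A_m` equals `C`. -/
def productTuples {n : ℕ} (m : ℕ) (M : Set (Matrix (Fin n) (Fin n) ℤ))
    (C : Matrix (Fin n) (Fin n) ℤ) : Set (Fin m → Matrix (Fin n) (Fin n) ℤ) :=
  {A | (∀ i, A i ∈ M) ∧ (List.ofFn A).prod = C}

theorem boundedMatrices_finite (n H : ℕ) : (boundedMatrices n H).Finite := by
  have h : {A : Fin n → Fin n → ℤ | ∀ i, A i ∈ {f : Fin n → ℤ |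
      ∀ j, f j ∈ Set.Icc (-(H : ℤ)) H}}.Finite :=
    Set.Finite.pi' fun _ => Set.Finite.pi' fun _ => Set.finite_Icc _ _
  exact h.subset fun A hA i j => abs_le.mp (hA i j)

/-- The solution sets are finite, so `Set.ncard` is their true cardinality. -/
theorem productTuples_finite (m n H : ℕ) (C : Matrix (Fin n) (Fin n) ℤ) :
    (productTuples m (boundedMatrices n H) C).Finite :=
  (Set.Finite.pi' fun _ : Fin m => boundedMatrices_finite n H).subset fun _ hA => hA.1

/-!
The whole count rests on one estimate: there are at most `H ^ (n r + ε)` integer `n × n` matrices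
of rank `r` and size `H` (`exists_ncard_rank_eq_le`, a form of Katznelson's theorem), and at most
`H ^ (n² - n + ε)` of given determinant `d ≠ 0`, uniformly in `d` (`exists_ncard_det_eq_le`).

To prove it, write a matrix of rank `r` as `A = A_J M`, where the columns `J` (and suitable rows)
carry a minor of maximal absolute value; by Cramer's rule the `r × n` rational matrix `M` has
entries in `[-1, 1]`, and it is the identity on the columns `J` (`exists_row_factorization`). For
given `M` the rows of `A_J` are points of the lattice `Λ = {y ∈ ℤʳ : y M ∈ ℤⁿ}`, which contains
`r` independent vectors of size `H`. Modulo `1` the rows of `M` are elements `x₁, …, x_r` of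
`(ℚ/ℤ)ⁿ⁻ʳ`, and `Λ` is their lattice of relations, so that `ℤʳ / Λ` is the group `G` that they
generate. Translating the points of `Λ` in the box by small representatives of `G` gives
`#(Λ ∩ box) · |G| ≤ (c H)ʳ` (`ncard_boundedRelations_mul_card_le`), so that the `n` rows of `A_J`
can be chosen in at most `(c H)ⁿʳ |G|⁻ⁿ` ways. The sum of `|G|⁻ⁿ` over all `r`-tuples `x` with
`|G| ≤ T` is only a power of `log T` (`tsum_subgroupWeight_closure_le`): a further generator of
order `d` modulo the group `G` generated so far can be chosen in at most `|G| dⁿ⁻ʳ` ways. For the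
determinant the same applies to the first `n - 1` rows, and given these the last row varies in a
translate of the same lattice.

For nonsingular `C` the determinant of each factor divides `det C`, so that the divisor bound and
the determinant count bound the choices of `A₂, …, A_m`, and `A₁` is determined by them. For
arbitrary `C`, given `A₂, …, A_m` with product `P`, there are at most `(2 H + 1) ^ (n (n - rank P))`
choices of `A₁`; by Sylvester's inequality `n - rank P ≤ ∑ (n - rank Aᵢ)`, so the count is at most
`(∑_A (2 H + 1) ^ (n (n - rank A))) ^ (m - 1)`, which the rank count bounds by
`H ^ ((m - 1) n² + ε)`. This covers the zero matrix and the singular matrices; with at least three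
factors, or indeed two, the exponent `m n² - n` is larger than this one, because `n ≥ 2`.
-/

open scoped ENNReal Matrix

/-! ### Weighted sums over finitely generated torsion groups -/

/-- The weight `|G|⁻ˢ` of a subgroup `G` with at most `T` elements; infinite subgroups
(for which `Nat.card G = 0`) and subgroups with more than `T` elements have weight `0`. -/
noncomputable def subgroupWeight {E : Type*} [AddCommGroup E] (T s : ℕ)
    (G : AddSubgroup E) : ℝ≥0∞ :=
  if Nat.card G ∈ Finset.Icc 1 T then ((Nat.card G : ℝ≥0∞) ^ s)⁻¹ else 0

theorem encard_nsmul_eq_le {E : Type*} [AddCommGroup E] {k d : ℕ}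
    (hE : {x : E | d • x = 0}.encard ≤ (d : ℕ∞) ^ k) (g : E) :
    {x : E | d • x = g}.encard ≤ (d : ℕ∞) ^ k := by
  rcases Set.eq_empty_or_nonempty {x : E | d • x = g} with h | ⟨x₀, hx₀⟩
  · simp [h]
  · refine le_trans ?_ hE
    rw [← (sub_left_injective (b := x₀)).encard_image {x : E | d • x = g}]
    refine Set.encard_le_encard ?_
    rintro _ ⟨x, hx, rfl⟩
    simp only [Set.mem_ofPred_eq] at hx hx₀ ⊢
    rw [smul_sub, hx, hx₀, sub_self]

theorem tsum_indicator_nsmul_mem_le {E : Type*} [AddCommGroup E] {k d : ℕ}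
    (hE : {x : E | d • x = 0}.encard ≤ (d : ℕ∞) ^ k) (G : AddSubgroup E) [Finite G] :
    ∑' e : E, Set.indicator {e : E | d • e ∈ G} (1 : E → ℝ≥0∞) e ≤
      (Nat.card G : ℝ≥0∞) * (d : ℝ≥0∞) ^ k := by
  have := Fintype.ofFinite G
  calc ∑' e : E, Set.indicator {e : E | d • e ∈ G} (1 : E → ℝ≥0∞) e
      ≤ ∑' e : E, ∑ g : G, Set.indicator {e : E | d • e = g} (1 : E → ℝ≥0∞) e := by
        refine ENNReal.tsum_le_tsum fun e => ?_
        by_cases he : d • e ∈ G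
        · rw [Set.indicator_of_mem (by exact he)]
          refine le_trans ?_ (Finset.single_le_sum (fun _ _ => zero_le)
            (Finset.mem_univ (⟨d • e, he⟩ : G)))
          simp
        · rw [Set.indicator_of_notMem (by exact he)]
          exact zero_le
    _ = ∑ g : G, ∑' e : E, Set.indicator {e : E | d • e = g} (1 : E → ℝ≥0∞) e :=
        Summable.tsum_finsetSum fun _ _ => ENNReal.summable
    _ ≤ ∑ g : G, (d : ℝ≥0∞) ^ k := by
        refine Finset.sum_le_sum fun g _ => ?_
        rw [← tsum_subtype]
        simp only [Pi.one_apply, ENNReal.tsum_set_one]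
        have := ENat.toENNReal_mono (encard_nsmul_eq_le hE (g : E))
        simpa using! this
    _ = _ := by simp

theorem subgroupWeight_sup_zmultiples_le {E : Type*} [AddCommGroup E] (T s : ℕ)
    (G : AddSubgroup E) (e : E) :
    subgroupWeight T s (G ⊔ AddSubgroup.zmultiples e) ≤
      ∑ d ∈ Finset.Icc 1 T, Set.indicator {e : E | d • e ∈ G} (1 : E → ℝ≥0∞) e *
        (((Nat.card G : ℝ≥0∞) ^ s)⁻¹ * ((d : ℝ≥0∞) ^ s)⁻¹) := by
  set G' := G ⊔ AddSubgroup.zmultiples e with hG'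
  by_cases h : Nat.card G' ∈ Finset.Icc 1 T
  swap
  · simp [subgroupWeight, h]
  have hle : G ≤ G' := le_sup_left
  obtain ⟨h1, h2⟩ := Finset.mem_Icc.1 h
  have hfin : Finite G' := Nat.finite_of_card_ne_zero (by omega)
  have hcard : Nat.card G * G.relIndex G' = Nat.card G' := by
    have := AddSubgroup.card_mul_index (G.addSubgroupOf G')
    rwa [Nat.card_congr (AddSubgroup.addSubgroupOfEquivOfLe hle).toEquiv] at this
  set d := G.relIndex G' with hd
  have hd0 : d ≠ 0 := by
    intro h0; rw [h0] at hcard; omega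
  have hg0 : Nat.card G ≠ 0 := by
    intro h0; rw [h0] at hcard; omega
  have hdT : d ∈ Finset.Icc 1 T := by
    refine Finset.mem_Icc.2 ⟨by omega, le_trans ?_ h2⟩
    rw [← hcard]
    exact Nat.le_mul_of_pos_left _ (by omega)
  have he : d • e ∈ G := by
    have heG : e ∈ G' := hG' ▸ AddSubgroup.mem_sup_right (AddSubgroup.mem_zmultiples e)
    have := AddSubgroup.nsmul_index_mem (G.addSubgroupOf G') ⟨e, heG⟩
    simpa [AddSubgroup.mem_addSubgroupOf] using! this
  refine le_trans ?_ (Finset.single_le_sum (fun _ _ => zero_le) hdT)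
  rw [Set.indicator_of_mem (by exact he), subgroupWeight, if_pos h, ← hcard]
  simp only [Pi.one_apply, one_mul, Nat.cast_mul, mul_pow]
  rw [ENNReal.mul_inv] <;> simp [hg0, hd0]

/-- Adjoining one more generator to `G`: order `d` modulo `G` is possible in at most `|G| dᵏ`
ways, and divides the weight `|G| ^ (-(s + 1))` by `d ^ (s + 1)`. -/
theorem tsum_subgroupWeight_sup_zmultiples_le {E : Type*} [AddCommGroup E] {k : ℕ}
    (hE : ∀ d : ℕ, d ≠ 0 → {x : E | d • x = 0}.encard ≤ (d : ℕ∞) ^ k) (T : ℕ) {s : ℕ}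
    (hs : k ≤ s) (G : AddSubgroup E) :
    ∑' e : E, subgroupWeight T (s + 1) (G ⊔ AddSubgroup.zmultiples e) ≤
      (∑ d ∈ Finset.Icc 1 T, (d : ℝ≥0∞)⁻¹) * subgroupWeight T s G := by
  by_cases h : Nat.card G ∈ Finset.Icc 1 T
  swap
  · -- a subgroup containing `G` is infinite or has more than `T` elements as well
    have : ∀ e : E, subgroupWeight T (s + 1) (G ⊔ AddSubgroup.zmultiples e) = 0 := by
      intro e
      refine if_neg fun h' => h ?_
      obtain ⟨h1, h2⟩ := Finset.mem_Icc.1 h'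
      have hfin : Finite ↥(G ⊔ AddSubgroup.zmultiples e) := Nat.finite_of_card_ne_zero (by omega)
      have hle : G ≤ G ⊔ AddSubgroup.zmultiples e := le_sup_left
      have := AddSubgroup.card_dvd_of_le hle
      refine Finset.mem_Icc.2 ⟨?_, (Nat.le_of_dvd (by omega) this).trans h2⟩
      exact Nat.pos_of_dvd_of_pos this (by omega)
    simp [this]
  obtain ⟨h1, h2⟩ := Finset.mem_Icc.1 h
  have hfin : Finite G := Nat.finite_of_card_ne_zero (by omega)
  have hg : (Nat.card G : ℝ≥0∞) ≠ 0 := by simp; omega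
  have hgt : (Nat.card G : ℝ≥0∞) ≠ ∞ := ENNReal.natCast_ne_top _
  calc ∑' e : E, subgroupWeight T (s + 1) (G ⊔ AddSubgroup.zmultiples e)
      ≤ ∑' e : E, ∑ d ∈ Finset.Icc 1 T, Set.indicator {e : E | d • e ∈ G} (1 : E → ℝ≥0∞) e *
        (((Nat.card G : ℝ≥0∞) ^ (s + 1))⁻¹ * ((d : ℝ≥0∞) ^ (s + 1))⁻¹) :=
        ENNReal.tsum_le_tsum fun e => subgroupWeight_sup_zmultiples_le T (s + 1) G e
    _ = ∑ d ∈ Finset.Icc 1 T, (∑' e : E, Set.indicator {e : E | d • e ∈ G} (1 : E → ℝ≥0∞) e) *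
        (((Nat.card G : ℝ≥0∞) ^ (s + 1))⁻¹ * ((d : ℝ≥0∞) ^ (s + 1))⁻¹) := by
        rw [Summable.tsum_finsetSum fun _ _ => ENNReal.summable]
        simp_rw [ENNReal.tsum_mul_right]
    _ ≤ ∑ d ∈ Finset.Icc 1 T, (d : ℝ≥0∞)⁻¹ * ((Nat.card G : ℝ≥0∞) ^ s)⁻¹ := by
        refine Finset.sum_le_sum fun d hd => ?_
        have hd1 : 1 ≤ d := (Finset.mem_Icc.1 hd).1
        have hd0 : (d : ℝ≥0∞) ≠ 0 := by simp; omega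
        have hdt : (d : ℝ≥0∞) ≠ ∞ := ENNReal.natCast_ne_top _
        calc _ ≤ (Nat.card G : ℝ≥0∞) * (d : ℝ≥0∞) ^ k *
              (((Nat.card G : ℝ≥0∞) ^ (s + 1))⁻¹ * ((d : ℝ≥0∞) ^ (s + 1))⁻¹) := by
              gcongr
              exact tsum_indicator_nsmul_mem_le (hE d (by omega)) G
          _ ≤ (Nat.card G : ℝ≥0∞) * (d : ℝ≥0∞) ^ s *
              (((Nat.card G : ℝ≥0∞) ^ (s + 1))⁻¹ * ((d : ℝ≥0∞) ^ (s + 1))⁻¹) := by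
              gcongr
              exact_mod_cast hd1
          _ = ((Nat.card G : ℝ≥0∞) * (Nat.card G : ℝ≥0∞)⁻¹) *
                ((d : ℝ≥0∞) ^ s * ((d : ℝ≥0∞) ^ s)⁻¹) *
                ((d : ℝ≥0∞)⁻¹ * ((Nat.card G : ℝ≥0∞) ^ s)⁻¹) := by
              rw [pow_succ, pow_succ, ENNReal.mul_inv (by simp) (by simp),
                ENNReal.mul_inv (by simp) (by simp)]
              ring
          _ = _ := by
              rw [ENNReal.mul_inv_cancel hg hgt, ENNReal.mul_inv_cancel (by positivity)
                (ENNReal.pow_ne_top hdt)]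
              simp
    _ = _ := by rw [← Finset.sum_mul, subgroupWeight, if_pos h]

/-- If `E` has at most `dᵏ` elements of each torsion order `d`, the subgroups generated by
`r`-tuples satisfy `∑ |⟨x₁, …, x_r⟩|⁻ˢ ≤ (∑_{d ≤ T} 1/d)ʳ` as soon as `s ≥ k + r`.
Each generator costs one unit of the exponent `s` and one harmonic sum. -/
theorem tsum_subgroupWeight_closure_le {E : Type*} [AddCommGroup E] {k : ℕ}
    (hE : ∀ d : ℕ, d ≠ 0 → {x : E | d • x = 0}.encard ≤ (d : ℕ∞) ^ k) (T : ℕ) (r s : ℕ)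
    (hs : k + r ≤ s) :
    ∑' x : Fin r → E, subgroupWeight T s (AddSubgroup.closure (Set.range x)) ≤
      (∑ d ∈ Finset.Icc 1 T, (d : ℝ≥0∞)⁻¹) ^ r := by
  induction r generalizing s with
  | zero =>
    rw [tsum_fintype, Fintype.sum_unique, subgroupWeight]
    split_ifs <;> simp
  | succ r ih =>
    obtain ⟨s, rfl⟩ : ∃ t, s = t + 1 := ⟨s - 1, by omega⟩
    rw [← (Fin.consEquiv fun _ => E).tsum_eq, ENNReal.tsum_prod', ENNReal.tsum_comm]
    calc _ = ∑' x : Fin r → E, ∑' e : E, subgroupWeight T (s + 1)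
            (AddSubgroup.closure (Set.range x) ⊔ AddSubgroup.zmultiples e) := by
          refine tsum_congr fun x => tsum_congr fun e => ?_
          congr 1
          simp only [Fin.consEquiv, Equiv.coe_fn_mk]
          rw [Fin.range_cons, ← Set.union_singleton, AddSubgroup.closure_union,
            AddSubgroup.zmultiples_eq_closure]
      _ ≤ ∑' x : Fin r → E, (∑ d ∈ Finset.Icc 1 T, (d : ℝ≥0∞)⁻¹) *
            subgroupWeight T s (AddSubgroup.closure (Set.range x)) :=
          ENNReal.tsum_le_tsum fun x =>
            tsum_subgroupWeight_sup_zmultiples_le hE T (by omega) _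
      _ ≤ _ := by
          rw [ENNReal.tsum_mul_left, pow_succ']
          gcongr
          exact ih s (by omega)

/-- The group `(ℚ/ℤ)^ι` satisfies the torsion hypothesis of `tsum_subgroupWeight_closure_le` with
`k = |ι|`. -/
theorem encard_pi_addCircle_torsion_le (ι : Type*) [Fintype ι] (d : ℕ) (hd : d ≠ 0) :
    {x : ι → AddCircle (1 : ℚ) | d • x = 0}.encard ≤ (d : ℕ∞) ^ Fintype.card ι := by
  have hreg : IsSMulRegular ℚ d := .of_right_eq_zero_of_smul fun _ ↦ by simp [hd]
  have h := AddCircle.card_torsion_le_of_isSMulRegular (1 : ℚ) d hd hreg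
  have hpi : {x : ι → AddCircle (1 : ℚ) | d • x = 0} =
      Set.univ.pi fun _ => {x : AddCircle (1 : ℚ) | d • x = 0} := by
    ext x; simp [funext_iff]
  rw [hpi]
  classical
  rw [Set.encard_pi_eq_prod_encard]
  exact (Finset.prod_le_prod' fun _ _ => h).trans (by simp)

/-! ### Small relations and the index bound -/

/-- The integer relations `∑ yᵢ xᵢ = 0` between `x₁, …, x_r` with coefficients at most `H` in
absolute value. -/
def boundedRelations {E : Type*} [AddCommGroup E] {r : ℕ} (x : Fin r → E) (H : ℕ) :
    Set (Fin r → ℤ) :=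
  {y | (∀ i, |y i| ≤ (H : ℤ)) ∧ ∑ i, y i • x i = 0}

theorem ncard_box (ι : Type*) [Fintype ι] (K : ℕ) :
    {y : ι → ℤ | ∀ i, |y i| ≤ (K : ℤ)}.ncard = (2 * K + 1) ^ Fintype.card ι := by
  classical
  have : {y : ι → ℤ | ∀ i, |y i| ≤ (K : ℤ)} =
      ↑(Fintype.piFinset fun _ : ι => Finset.Icc (-(K : ℤ)) K) := by
    ext y; simp [abs_le, Pi.le_def, forall_and]
  rw [this, Set.ncard_coe_finset, Fintype.card_piFinset]
  simp only [Int.card_Icc, Finset.prod_const, Finset.card_univ]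
  congr 1
  omega

theorem finite_box (ι : Type*) [Finite ι] (K : ℕ) :
    {y : ι → ℤ | ∀ i, |y i| ≤ (K : ℤ)}.Finite :=
  (Set.Finite.pi' fun _ : ι => Set.finite_Icc (-(K : ℤ)) K).subset fun _ hy i => abs_le.1 (hy i)

theorem finite_boundedRelations {E : Type*} [AddCommGroup E] {r : ℕ} (x : Fin r → E) (H : ℕ) :
    (boundedRelations x H).Finite :=
  (finite_box (Fin r) H).subset fun _ hy => hy.1

/-- If `r` linearly independent relations of size `H` are known, every element of the group
generated by `x` is a combination of `x` with coefficients of size `r H`: reduce modulo the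
parallelepiped spanned by the relations. -/
theorem exists_small_coeffs_of_mem_closure {E : Type*} [AddCommGroup E] {r : ℕ} {x : Fin r → E}
    {H : ℕ} {V : Matrix (Fin r) (Fin r) ℤ} (hdet : V.det ≠ 0)
    (hV : ∀ i, V i ∈ boundedRelations x H) {g : E}
    (hg : g ∈ AddSubgroup.closure (Set.range x)) :
    ∃ y : Fin r → ℤ, (∀ i, |y i| ≤ ((r * H : ℕ) : ℤ)) ∧ ∑ i, y i • x i = g := by
  obtain ⟨y, hy⟩ : ∃ y : Fin r → ℤ, ∑ i, y i • x i = g := by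
    rw [← Submodule.mem_span_range_iff_exists_fun ℤ]
    rw [← Submodule.span_int_eq_addSubgroupClosure] at hg
    exact hg
  set W : Matrix (Fin r) (Fin r) ℚ := V.map (Int.cast : ℤ → ℚ) with hW
  have hWdet : IsUnit W.det := by
    have : W.det = ((V.det : ℤ) : ℚ) := (Int.cast_det V).symm
    rw [this, isUnit_iff_ne_zero]
    exact_mod_cast hdet
  set c : Fin r → ℚ := Matrix.vecMul (fun i => (y i : ℚ)) W⁻¹ with hc
  have hcW : ∀ j, (y j : ℚ) = ∑ i, c i * (V i j : ℚ) := by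
    intro j
    have : Matrix.vecMul c W = fun i => (y i : ℚ) := by
      rw [hc, Matrix.vecMul_vecMul, Matrix.nonsing_inv_mul _ hWdet, Matrix.vecMul_one]
    have := congrFun this j
    simpa [Matrix.vecMul, dotProduct, hW] using this.symm
  refine ⟨fun j => y j - ∑ i, ⌊c i⌋ * V i j, fun j => ?_, ?_⟩
  · have h1 : ((y j - ∑ i, ⌊c i⌋ * V i j : ℤ) : ℚ) = ∑ i, Int.fract (c i) * (V i j : ℚ) := by
      push_cast
      rw [hcW j, ← Finset.sum_sub_distrib]
      exact Finset.sum_congr rfl fun i _ => by rw [← sub_mul, Int.self_sub_floor]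
    have h2 : |((y j - ∑ i, ⌊c i⌋ * V i j : ℤ) : ℚ)| ≤ ((r * H : ℕ) : ℚ) := by
      rw [h1]
      calc _ ≤ ∑ i, |Int.fract (c i) * (V i j : ℚ)| := Finset.abs_sum_le_sum_abs _ _
        _ ≤ ∑ i : Fin r, (H : ℚ) := by
            refine Finset.sum_le_sum fun i _ => ?_
            rw [abs_mul, abs_of_nonneg (Int.fract_nonneg _)]
            have hVij : |(V i j : ℚ)| ≤ H := by exact_mod_cast (hV i).1 j
            calc _ ≤ 1 * |(V i j : ℚ)| := by
                  gcongr
                  exact (Int.fract_lt_one _).le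
              _ ≤ _ := by rwa [one_mul]
        _ = _ := by simp
    exact_mod_cast h2
  · simp only [sub_smul, Finset.sum_sub_distrib, hy, Finset.sum_smul]
    rw [Finset.sum_comm]
    have : ∀ i, ∑ j, (⌊c i⌋ * V i j) • x j = 0 := by
      intro i
      simp only [mul_smul, ← Finset.smul_sum]
      rw [(hV i).2, smul_zero]
    simp [this]

/-- The index bound: translates of the small relations by small representatives of the elements
of `⟨x₁, …, x_r⟩` are pairwise distinct points of a box. -/
theorem ncard_boundedRelations_mul_card_le {E : Type*} [AddCommGroup E] {r : ℕ} {x : Fin r → E}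
    {H : ℕ} {V : Matrix (Fin r) (Fin r) ℤ} (hdet : V.det ≠ 0)
    (hV : ∀ i, V i ∈ boundedRelations x H) :
    Nat.card (AddSubgroup.closure (Set.range x)) ≠ 0 ∧
      (boundedRelations x H).ncard * Nat.card (AddSubgroup.closure (Set.range x)) ≤
        (2 * ((r + 1) * H) + 1) ^ r := by
  have hρ : ∀ g : AddSubgroup.closure (Set.range x), ∃ y : Fin r → ℤ,
      (∀ i, |y i| ≤ ((r * H : ℕ) : ℤ)) ∧ ∑ i, y i • x i = g := fun g =>
    exists_small_coeffs_of_mem_closure hdet hV g.2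
  choose ρ hρ1 hρ2 using hρ
  have hρinj : Function.Injective ρ := fun g g' h => Subtype.ext (by rw [← hρ2, ← hρ2, h])
  have hfin : Finite (AddSubgroup.closure (Set.range x)) := by
    have := (finite_box (Fin r) (r * H)).to_subtype
    exact Finite.of_injective (fun g => (⟨ρ g, hρ1 g⟩ :
      {y : Fin r → ℤ | ∀ i, |y i| ≤ ((r * H : ℕ) : ℤ)})) fun g g' h => hρinj (by simpa using h)
  refine ⟨Nat.card_pos.ne', ?_⟩
  have hbox := ncard_box (Fin r) ((r + 1) * H)
  rw [Fintype.card_fin] at hbox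
  rw [← hbox, ← Nat.card_coe_set_eq, ← Nat.card_coe_set_eq, ← Nat.card_prod]
  have := (finite_box (Fin r) ((r + 1) * H)).to_subtype
  refine Nat.card_le_card_of_injective (fun p => (⟨p.1.1 + ρ p.2, fun i => ?_⟩ :
      {y : Fin r → ℤ | ∀ i, |y i| ≤ (((r + 1) * H : ℕ) : ℤ)})) ?_
  · have h1 := p.1.2.1 i
    have h2 := hρ1 p.2 i
    calc _ ≤ |p.1.1 i| + |ρ p.2 i| := abs_add_le _ _
      _ ≤ _ := by push_cast at *; linarith
  · rintro ⟨y, g⟩ ⟨y', g'⟩ h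
    have h' : y.1 + ρ g = y'.1 + ρ g' := by simpa using h
    have hgg : g = g' := by
      have key : ∀ (y : boundedRelations x H) (g : AddSubgroup.closure (Set.range x)),
          ∑ i, (y.1 + ρ g) i • x i = g := by
        intro y g
        simp only [Pi.add_apply, add_smul, Finset.sum_add_distrib, y.2.2, hρ2, zero_add]
      exact Subtype.ext (by rw [← key y g, ← key y' g', h'])
    subst hgg
    simpa [Subtype.ext_iff] using! h'

/-- The index bound turns the number of relations into the weight `|G|⁻ⁿ`, whose sum over all
tuples is logarithmic. -/
theorem sum_ncard_boundedRelations_pow_le {ι : Type*} [Fintype ι] {r n : ℕ}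
    (hn : Fintype.card ι + r = n) {H : ℕ} (F : Finset (Fin r → ι → AddCircle (1 : ℚ)))
    (hF : ∀ x ∈ F, ∃ V : Matrix (Fin r) (Fin r) ℤ, V.det ≠ 0 ∧
      ∀ i, V i ∈ boundedRelations x H) :
    ∑ x ∈ F, ((boundedRelations x H).ncard : ℝ) ^ n ≤
      (((2 * ((r + 1) * H) + 1) ^ r : ℕ) : ℝ) ^ n *
        (1 + Real.log ((2 * ((r + 1) * H) + 1) ^ r : ℕ)) ^ r := by
  set T : ℕ := (2 * ((r + 1) * H) + 1) ^ r with hT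
  have h1 : ∑ x ∈ F, ((boundedRelations x H).ncard : ℝ≥0∞) ^ n ≤
      (T : ℝ≥0∞) ^ n * (∑ d ∈ Finset.Icc 1 T, (d : ℝ≥0∞)⁻¹) ^ r := by
    calc _ ≤ ∑ x ∈ F, (T : ℝ≥0∞) ^ n *
          subgroupWeight T n (AddSubgroup.closure (Set.range x)) := by
          refine Finset.sum_le_sum fun x hx => ?_
          obtain ⟨V, hdet, hV⟩ := hF x hx
          obtain ⟨h0, hle⟩ := ncard_boundedRelations_mul_card_le hdet hV
          have hcT : Nat.card (AddSubgroup.closure (Set.range x)) ∈ Finset.Icc 1 T := by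
            refine Finset.mem_Icc.2 ⟨Nat.pos_of_ne_zero h0, ?_⟩
            have hpos : 0 < (boundedRelations x H).ncard := by
              refine Set.ncard_pos (finite_boundedRelations x H) |>.2 ⟨0, ?_⟩
              simp [boundedRelations]
            exact (Nat.le_mul_of_pos_left _ hpos).trans hle
          rw [subgroupWeight, if_pos hcT, ENNReal.inv_pow, ← mul_pow]
          gcongr
          rw [← div_eq_mul_inv, ENNReal.le_div_iff_mul_le (by simp [h0]) (by simp)]
          exact_mod_cast hle
      _ ≤ (T : ℝ≥0∞) ^ n * ∑' x : Fin r → ι → AddCircle (1 : ℚ),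
          subgroupWeight T n (AddSubgroup.closure (Set.range x)) := by
          rw [← Finset.mul_sum]
          gcongr
          exact ENNReal.sum_le_tsum F
      _ ≤ _ := by
          gcongr
          exact tsum_subgroupWeight_closure_le (encard_pi_addCircle_torsion_le ι) T r n hn.le
  have h2 : (∑ d ∈ Finset.Icc 1 T, (d : ℝ≥0∞)⁻¹) ≤ ENNReal.ofReal (1 + Real.log T) := by
    have hh : (∑ d ∈ Finset.Icc 1 T, (d : ℝ≥0∞)⁻¹) =
        ENNReal.ofReal (∑ d ∈ Finset.Icc 1 T, (d : ℝ)⁻¹) := by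
      rw [ENNReal.ofReal_sum_of_nonneg fun _ _ => by positivity]
      refine Finset.sum_congr rfl fun d hd => ?_
      have : 0 < (d : ℝ) := by exact_mod_cast (Finset.mem_Icc.1 hd).1
      rw [ENNReal.ofReal_inv_of_pos this, ENNReal.ofReal_natCast]
    rw [hh]
    refine ENNReal.ofReal_le_ofReal ?_
    have := harmonic_le_one_add_log T
    rw [harmonic_eq_sum_Icc] at this
    push_cast at this
    exact this
  have hlog : 0 ≤ 1 + Real.log (T : ℝ) := by
    have := Real.log_natCast_nonneg T
    linarith
  have h3 := h1.trans (mul_le_mul_right (pow_le_pow_left₀ zero_le h2 r) _)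
  have h4 : ENNReal.ofReal (∑ x ∈ F, ((boundedRelations x H).ncard : ℝ) ^ n) ≤
      ENNReal.ofReal ((T : ℝ) ^ n * (1 + Real.log T) ^ r) := by
    rw [ENNReal.ofReal_sum_of_nonneg fun _ _ => by positivity,
      ENNReal.ofReal_mul (by positivity), ENNReal.ofReal_pow (by positivity),
      ENNReal.ofReal_pow hlog, ENNReal.ofReal_natCast]
    refine le_trans (le_of_eq ?_) h3
    refine Finset.sum_congr rfl fun x _ => ?_
    rw [ENNReal.ofReal_pow (by positivity), ENNReal.ofReal_natCast]
  exact (ENNReal.ofReal_le_ofReal_iff (by positivity)).1 h4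

/-! ### Factorization along a maximal minor -/

theorem exists_linearIndependent_cols {K m n : Type*} [Field K] [Finite m] [Fintype n]
    {A : Matrix m n K} {r : ℕ} (hr : A.rank = r) :
    ∃ J : Fin r → n, LinearIndependent K (A.submatrix id J).col := by
  obtain ⟨κ, a, ha, hspan, hli⟩ := exists_linearIndependent' K A.col
  have : Fintype κ := Fintype.ofInjective a ha
  have hcard : Fintype.card κ = r := by
    rw [← hr, A.rank_eq_finrank_span_cols, ← hspan, finrank_span_eq_card hli]
  let f : Fin r ≃ κ := (Fintype.equivFinOfCardEq hcard).symm
  exact ⟨a ∘ f, hli.comp f f.injective⟩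

theorem exists_submatrix_det_ne_zero {K m n : Type*} [Field K] [Fintype m] [Fintype n]
    {A : Matrix m n K} {r : ℕ} (hr : A.rank = r) :
    ∃ (e : Fin r → m) (J : Fin r → n), (A.submatrix e J).det ≠ 0 := by
  obtain ⟨J, hJ⟩ := exists_linearIndependent_cols hr
  have hrank : (A.submatrix id J)ᵀ.rank = r := by
    have := LinearIndependent.rank_matrix (M := (A.submatrix id J)ᵀ) hJ
    simpa using this
  obtain ⟨e, he⟩ := exists_linearIndependent_cols hrank
  refine ⟨e, J, ?_⟩
  have h : IsUnit ((A.submatrix id J)ᵀ.submatrix id e) :=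
    Matrix.linearIndependent_cols_iff_isUnit.1 he
  have h' : (A.submatrix id J)ᵀ.submatrix id e = (A.submatrix e J)ᵀ := rfl
  rw [h', Matrix.isUnit_iff_isUnit_det, Matrix.det_transpose] at h
  exact h.ne_zero

/-- An integer matrix `A` of rank `r` factors as `A_J M`, where `J` is the set of columns of an
`r × r` minor of maximal absolute value. -/
theorem exists_row_factorization {p n r : ℕ} {A : Matrix (Fin p) (Fin n) ℤ}
    (hr : (A.map (Int.cast : ℤ → ℚ)).rank = r) :
    ∃ (e : Fin r → Fin p) (J : Fin r → Fin n) (M : Matrix (Fin r) (Fin n) ℚ),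
      (A.submatrix e J).det ≠ 0 ∧ M.submatrix id J = 1 ∧ (∀ i j, |M i j| ≤ 1) ∧
      A.map (Int.cast : ℤ → ℚ) = (A.submatrix id J).map (Int.cast : ℤ → ℚ) * M := by
  set Q : Matrix (Fin p) (Fin n) ℚ := A.map (Int.cast : ℤ → ℚ) with hQ
  obtain ⟨e₀, J₀, h₀⟩ := exists_submatrix_det_ne_zero hr
  have : Nonempty ((Fin r → Fin p) × (Fin r → Fin n)) := ⟨(e₀, J₀)⟩
  obtain ⟨⟨e, J⟩, hmax⟩ := Finite.exists_max
    fun q : (Fin r → Fin p) × (Fin r → Fin n) => |(Q.submatrix q.1 q.2).det|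
  have hdet : (Q.submatrix e J).det ≠ 0 := by
    have h1 := hmax (e₀, J₀)
    have h2 := abs_pos.2 h₀
    exact abs_pos.1 (h2.trans_le h1)
  have hunit : IsUnit (Q.submatrix e J).det := isUnit_iff_ne_zero.2 hdet
  set M := (Q.submatrix e J)⁻¹ * Q.submatrix e id with hM
  refine ⟨e, J, M, ?_, ?_, ?_, ?_⟩
  · intro h
    apply hdet
    have : Q.submatrix e J = (A.submatrix e J).map (Int.cast : ℤ → ℚ) := rfl
    rw [this]
    have := (Int.cast_det (R := ℚ) (A.submatrix e J)).symm
    rw [h] at this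
    simpa using this
  · have : M.submatrix id J = (Q.submatrix e J)⁻¹ * Q.submatrix e J := by
      ext i j; simp [hM, Matrix.mul_apply]
    rw [this, Matrix.nonsing_inv_mul _ hunit]
  · -- Cramer's rule: the entries of `M` are quotients of minors of `A` by the maximal one
    intro i j
    have h1 : M i j = ((Q.submatrix e J)⁻¹.mulVec fun i => Q (e i) j) i := by
      simp [hM, Matrix.mul_apply, Matrix.mulVec, dotProduct]
    have h2 : (Q.submatrix e J).updateCol i (fun i => Q (e i) j) =
        Q.submatrix e (Function.update J i j) := by
      ext a b
      by_cases hb : b = i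
      · subst hb; simp
      · simp [hb]
    rw [h1, Matrix.inv_def, Matrix.smul_mulVec, ← Matrix.cramer_eq_adjugate_mulVec, Pi.smul_apply,
      Matrix.cramer_apply, h2, Ring.inverse_eq_inv', smul_eq_mul, abs_mul, abs_inv,
      inv_mul_le_iff₀ (abs_pos.2 hdet), mul_one]
    exact hmax (e, Function.update J i j)
  · have hJli : LinearIndependent ℚ (Q.submatrix id J).col := by
      have h1 : LinearIndependent ℚ (Q.submatrix e J).col :=
        Matrix.linearIndependent_cols_iff_isUnit.2 ((Matrix.isUnit_iff_isUnit_det _).2 hunit)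
      exact LinearIndependent.of_comp (LinearMap.funLeft ℚ ℚ e) h1
    have hle : Submodule.span ℚ (Set.range (Q.submatrix id J).col) ≤
        Submodule.span ℚ (Set.range Q.col) :=
      Submodule.span_mono (by rintro _ ⟨i, rfl⟩; exact ⟨J i, rfl⟩)
    have heq := Submodule.eq_of_le_of_finrank_eq hle (by
      rw [finrank_span_eq_card hJli, ← Matrix.rank_eq_finrank_span_cols, hr, Fintype.card_fin])
    have hc : ∀ j, ∃ c : Fin r → ℚ, ∑ i, c i • (Q.submatrix id J).col i = Q.col j := fun j => by
      rw [← Submodule.mem_span_range_iff_exists_fun, heq]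
      exact Submodule.subset_span ⟨j, rfl⟩
    choose c hc using hc
    have hQc : Q = Q.submatrix id J * Matrix.of fun i j => c j i := by
      ext a j
      have := congrFun (hc j) a
      simp only [Finset.sum_apply, Pi.smul_apply, smul_eq_mul, Matrix.col_apply] at this
      rw [← this, Matrix.mul_apply]
      exact Finset.sum_congr rfl fun i _ => by simp [mul_comm]
    have hMc : M = Matrix.of fun i j => c j i := by
      have : Q.submatrix e id = Q.submatrix e J * Matrix.of fun i j => c j i := by
        conv_lhs => rw [hQc]
        ext a j; simp [Matrix.mul_apply]
      rw [hM, this, ← Matrix.mul_assoc, Matrix.nonsing_inv_mul _ hunit, Matrix.one_mul]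
    rw [hMc]
    exact hQc

/-! ### Counting through the fractional part of the row factor -/

/-- The integer vectors `y` of size at most `H` for which `y M` is integral. -/
def integralCombinations {r n : ℕ} (M : Matrix (Fin r) (Fin n) ℚ) (H : ℕ) : Set (Fin r → ℤ) :=
  {y | (∀ i, |y i| ≤ (H : ℤ)) ∧ ∀ j, ∃ z : ℤ, ∑ i, (y i : ℚ) * M i j = z}

theorem finite_integralCombinations {r n : ℕ} (M : Matrix (Fin r) (Fin n) ℚ) (H : ℕ) :
    (integralCombinations M H).Finite :=
  (finite_box (Fin r) H).subset fun _ hy => hy.1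

theorem integralCombinations_mono {r n : ℕ} (M : Matrix (Fin r) (Fin n) ℚ) {H H' : ℕ}
    (h : H ≤ H') : integralCombinations M H ⊆ integralCombinations M H' :=
  fun _ hy => ⟨fun i => (hy.1 i).trans (by exact_mod_cast h), hy.2⟩

/-- The reduction modulo `1` of the columns of `M` outside `J`. The columns `J` are left out because
`M` is the identity there; keeping them would raise the torsion exponent from `n - r` to `n`. -/
def fractionalPart {r n : ℕ} (M : Matrix (Fin r) (Fin n) ℚ) (J : Fin r → Fin n) :
    Fin r → {j : Fin n // j ∉ Set.range J} → AddCircle (1 : ℚ) :=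
  fun i j => (M i j : AddCircle (1 : ℚ))

theorem boundedRelations_fractionalPart {r n : ℕ} {M : Matrix (Fin r) (Fin n) ℚ}
    {J : Fin r → Fin n} (hJ : M.submatrix id J = 1) (H : ℕ) :
    boundedRelations (fractionalPart M J) H = integralCombinations M H := by
  ext y
  refine and_congr_right fun _ => ?_
  have hsum : ∀ j : {j : Fin n // j ∉ Set.range J},
      (∑ i, y i • fractionalPart M J i) j =
        ((∑ i, (y i : ℚ) * M i j : ℚ) : AddCircle (1 : ℚ)) := by
    intro j
    simp only [Finset.sum_apply, Pi.smul_apply, fractionalPart]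
    rw [← QuotientAddGroup.mk'_apply, map_sum]
    refine Finset.sum_congr rfl fun i _ => ?_
    rw [QuotientAddGroup.mk'_apply, ← zsmul_eq_mul]
    rfl
  constructor
  · intro h j
    by_cases hj : j ∈ Set.range J
    · obtain ⟨l, rfl⟩ := hj
      have : ∀ i, M i (J l) = (1 : Matrix (Fin r) (Fin r) ℚ) i l := fun i => by
        rw [← hJ]; rfl
      exact ⟨y l, by simp [this, Matrix.one_apply]⟩
    · have h' := congrFun h ⟨j, hj⟩
      rw [hsum] at h'
      obtain ⟨z, hz⟩ := AddCircle.coe_eq_zero_iff (1 : ℚ) |>.1 h'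
      exact ⟨z, by rw [← hz]; simp⟩
  · intro h
    funext j
    rw [hsum]
    obtain ⟨z, hz⟩ := h j
    exact AddCircle.coe_eq_zero_iff (1 : ℚ) |>.2 ⟨z, by rw [hz]; simp⟩

/-- The bound of `sum_ncard_boundedRelations_pow_le`, namely `Tⁿ (1 + log T)ʳ` with
`T = (2 (r + 1) H + 1)ʳ`. -/
noncomputable def relationBound (r n H : ℕ) : ℝ :=
  (((2 * ((r + 1) * H) + 1) ^ r : ℕ) : ℝ) ^ n *
    (1 + Real.log ((2 * ((r + 1) * H) + 1) ^ r : ℕ)) ^ r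

theorem relationBound_nonneg (r n H : ℕ) : 0 ≤ relationBound r n H := by
  have := Real.log_natCast_nonneg ((2 * ((r + 1) * H) + 1) ^ r)
  unfold relationBound
  positivity

theorem eq_of_fractionalPart_eq {r n : ℕ} {M M' : Matrix (Fin r) (Fin n) ℚ}
    {J : Fin r → Fin n} (hM : M.submatrix id J = 1) (hM' : M'.submatrix id J = 1)
    (hfloor : ∀ i j, ⌊M i j⌋ = ⌊M' i j⌋) (h : fractionalPart M J = fractionalPart M' J) :
    M = M' := by
  ext i j
  by_cases hj : j ∈ Set.range J
  · obtain ⟨l, rfl⟩ := hj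
    exact (congrFun (congrFun hM i) l).trans (congrFun (congrFun hM' i) l).symm
  · have h1 : (M i j : AddCircle (1 : ℚ)) = M' i j := congrFun (congrFun h i) ⟨j, hj⟩
    have h2 : ((M i j - M' i j : ℚ) : AddCircle (1 : ℚ)) = 0 := by
      rw [AddCircle.coe_sub, h1, sub_self]
    obtain ⟨z, hz⟩ := AddCircle.coe_eq_zero_iff (1 : ℚ) |>.1 h2
    have h3 : M i j = M' i j + z := by
      have : (z : ℚ) = M i j - M' i j := by simpa using hz
      linarith
    have h4 := hfloor i j
    rw [h3, Int.floor_add_intCast] at h4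
    have : z = 0 := by omega
    rw [h3, this]; simp

/-- If each object `a` carries a matrix `M a`, normalised to be the identity on the columns `J a`
and to have entries in `[-1, 1]`, and at most `#(integralCombinations (M a) H)ⁿ` objects carry the
same data, then there are few objects: `M a` is determined by its fractional part and by the floors
of its entries, which take three values. -/
theorem card_le_of_card_fiber_le {α : Type*} [Fintype α] {r n H : ℕ}
    (J : α → Fin r → Fin n) (M : α → Matrix (Fin r) (Fin n) ℚ)
    (hMJ : ∀ a, (M a).submatrix id (J a) = 1) (hM1 : ∀ a, ∀ i j, |M a i j| ≤ 1)
    (hV : ∀ a, ∃ V : Matrix (Fin r) (Fin r) ℤ, V.det ≠ 0 ∧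
      ∀ i, V i ∈ integralCombinations (M a) H)
    (hfib : ∀ b, ∀ S' : Finset α, (∀ a ∈ S', J a = J b ∧ M a = M b) →
      S'.card ≤ (integralCombinations (M b) H).ncard ^ n) :
    (Fintype.card α : ℝ) ≤ (n : ℝ) ^ r * (3 ^ n) ^ r * relationBound r n H := by
  classical
  let key : α → (Fin r → Fin n) × (Fin r → Fin n → ℤ) := fun a => (J a, fun i j => ⌊M a i j⌋)
  let T : Finset ((Fin r → Fin n) × (Fin r → Fin n → ℤ)) := Finset.univ ×ˢ
    Fintype.piFinset fun _ => Fintype.piFinset fun _ => Finset.Icc (-1) 1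
  have hkey : ∀ a, key a ∈ T := by
    intro a
    simp only [T, key, Finset.mem_product, Finset.mem_univ, true_and, Fintype.mem_piFinset,
      Finset.mem_Icc]
    intro i j
    have h := abs_le.1 (hM1 a i j)
    refine ⟨Int.le_floor.2 (by push_cast; exact h.1), ?_⟩
    exact_mod_cast (Int.floor_le (M a i j)).trans h.2
  have hT : (T.card : ℝ) = (n : ℝ) ^ r * (3 ^ n) ^ r := by
    simp [T, Finset.card_product]
  have hcell : ∀ t ∈ T, (((Finset.univ.filter fun a => key a = t).card : ℕ) : ℝ) ≤
      relationBound r n H := by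
    rintro ⟨J₀, fl⟩ -
    set S₀ := Finset.univ.filter fun a => key a = (J₀, fl) with hS₀
    rcases S₀.eq_empty_or_nonempty with h | ⟨a₀, ha₀⟩
    · rw [h]; simpa using relationBound_nonneg r n H
    have hJ₀ : ∀ a ∈ S₀, J a = J₀ := fun a ha =>
      congrArg Prod.fst (Finset.mem_filter.1 ha).2
    have hfl : ∀ a ∈ S₀, ∀ i j, ⌊M a i j⌋ = fl i j := fun a ha i j =>
      congrFun (congrFun (congrArg Prod.snd (Finset.mem_filter.1 ha).2) i) j
    have hMJ₀ : ∀ a ∈ S₀, (M a).submatrix id J₀ = 1 := fun a ha =>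
      hJ₀ a ha ▸ hMJ a
    have hinj : Function.Injective J₀ := by
      intro l l' hll
      by_contra hne
      have h1 := congrFun (congrFun (hMJ₀ a₀ ha₀) l) l
      have h2 := congrFun (congrFun (hMJ₀ a₀ ha₀) l) l'
      simp only [Matrix.submatrix_apply, id, Matrix.one_apply_eq, Matrix.one_apply_ne hne,
        ← hll] at h1 h2
      rw [h1] at h2
      exact one_ne_zero h2
    have hcard : Fintype.card {j : Fin n // j ∉ Set.range J₀} + r = n := by
      have h1 := Fintype.card_subtype_compl fun j => j ∈ Set.range J₀
      have h2 : Fintype.card {j // j ∈ Set.range J₀} = r := by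
        rw [← Fintype.card_congr (Equiv.ofInjective J₀ hinj), Fintype.card_fin]
      have h3 : r ≤ n := by simpa using Fintype.card_le_of_injective J₀ hinj
      rw [h2, Fintype.card_fin] at h1
      omega
    let φ := fun a => fractionalPart (M a) J₀
    have hF := sum_ncard_boundedRelations_pow_le hcard (H := H) (S₀.image φ) (by
      intro x hx
      obtain ⟨a, ha, rfl⟩ := Finset.mem_image.1 hx
      simp only [φ, boundedRelations_fractionalPart (hMJ₀ a ha)]
      exact hV a)
    refine le_trans ?_ hF
    rw [Finset.card_eq_sum_card_image φ S₀]
    push_cast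
    refine Finset.sum_le_sum fun x hx => ?_
    obtain ⟨b, hb, rfl⟩ := Finset.mem_image.1 hx
    simp only [φ, boundedRelations_fractionalPart (hMJ₀ b hb)]
    exact_mod_cast hfib b _ fun a ha => by
      obtain ⟨ha, hab⟩ := Finset.mem_filter.1 ha
      refine ⟨(hJ₀ a ha).trans (hJ₀ b hb).symm, ?_⟩
      exact eq_of_fractionalPart_eq (hMJ₀ a ha) (hMJ₀ b hb)
        (fun i j => (hfl a ha i j).trans (hfl b hb i j).symm) hab
  calc (Fintype.card α : ℝ)
      = ∑ t ∈ T, (((Finset.univ.filter fun a => key a = t).card : ℕ) : ℝ) := by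
        exact_mod_cast Finset.card_eq_sum_card_fiberwise (s := Finset.univ) fun a _ => hkey a
    _ ≤ ∑ t ∈ T, relationBound r n H := Finset.sum_le_sum hcell
    _ = _ := by rw [Finset.sum_const, nsmul_eq_mul, hT]

theorem exists_relationBound_le (r n : ℕ) {ε : ℝ} (hε : 0 < ε) :
    ∃ C : ℝ, 0 < C ∧ ∀ H : ℕ, 1 ≤ H →
      relationBound r n H ≤ C * (H : ℝ) ^ ((n : ℝ) * r + ε) := by
  set c : ℝ := 2 * (r + 1) + 1 with hc
  set δ : ℝ := ε / (r ^ 2 + 1) with hδ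
  have hδ0 : 0 < δ := by positivity
  refine ⟨c ^ (r * n) * ((1 + 1 / δ) ^ r * c ^ ε), by positivity, fun H hH => ?_⟩
  set T : ℕ := (2 * ((r + 1) * H) + 1) ^ r with hT
  have hH1 : (1 : ℝ) ≤ H := by exact_mod_cast hH
  have hT1 : (1 : ℝ) ≤ T := by
    exact_mod_cast Nat.one_le_pow _ _ (by positivity)
  have hTc : (T : ℝ) ≤ (c * H) ^ r := by
    rw [hT]; push_cast
    gcongr
    rw [hc]
    linarith
  have hcH : 1 ≤ c * H := by
    have : 1 ≤ c := by rw [hc]; linarith [(Nat.cast_nonneg r : (0 : ℝ) ≤ r)]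
    nlinarith
  have hlog : 1 + Real.log T ≤ (1 + 1 / δ) * (c * H) ^ (r * δ) := by
    have h1 := Real.log_le_rpow_div (Nat.cast_nonneg T : (0 : ℝ) ≤ T) hδ0
    have h2 : (T : ℝ) ^ δ ≤ (c * H) ^ (r * δ) := by
      calc (T : ℝ) ^ δ ≤ ((c * H) ^ r) ^ δ := by gcongr
        _ = _ := by rw [Real.rpow_mul (by positivity), Real.rpow_natCast]
    have h3 : (1 : ℝ) ≤ (T : ℝ) ^ δ := Real.one_le_rpow hT1 hδ0.le
    calc 1 + Real.log T ≤ (T : ℝ) ^ δ + (T : ℝ) ^ δ / δ := by linarith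
      _ = (1 + 1 / δ) * (T : ℝ) ^ δ := by ring
      _ ≤ _ := by gcongr
  have hlog0 := Real.log_natCast_nonneg T
  unfold relationBound
  rw [← hT]
  calc (T : ℝ) ^ n * (1 + Real.log T) ^ r
      ≤ ((c * H) ^ r) ^ n * ((1 + 1 / δ) * (c * H) ^ (r * δ)) ^ r := by gcongr
    _ = (c * H) ^ (r * n) * ((1 + 1 / δ) ^ r * (c * H) ^ (r * δ * r)) := by
        rw [← pow_mul, mul_pow (1 + 1 / δ), ← Real.rpow_mul_natCast (by positivity)]
    _ ≤ (c * H) ^ (r * n) * ((1 + 1 / δ) ^ r * (c * H) ^ ε) := by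
        have : r * δ * r ≤ ε := by
          rw [hδ]
          have : (r : ℝ) * (ε / (r ^ 2 + 1)) * r = ε * (r ^ 2 / (r ^ 2 + 1)) := by ring
          rw [this]
          have h1 : (r : ℝ) ^ 2 / (r ^ 2 + 1) ≤ 1 := by
            rw [div_le_one (by positivity)]; linarith
          nlinarith
        gcongr
    _ = _ := by
        rw [mul_pow, Real.mul_rpow (by positivity) (by positivity), Real.rpow_add (by positivity)]
        have : (H : ℝ) ^ ((n : ℝ) * r) = (H : ℝ) ^ (r * n) := by
          rw [← Real.rpow_natCast]; push_cast; rw [mul_comm]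
        rw [this]; ring

/-! ### Matrices of given rank and of given determinant -/

theorem mem_integralCombinations_of_eq_mul {p n r H : ℕ} {A : Matrix (Fin p) (Fin n) ℤ}
    {J : Fin r → Fin n} {M : Matrix (Fin r) (Fin n) ℚ}
    (hA : A.map (Int.cast : ℤ → ℚ) = (A.submatrix id J).map (Int.cast : ℤ → ℚ) * M)
    (hH : ∀ i j, |A i j| ≤ (H : ℤ)) (a : Fin p) :
    (A.submatrix id J) a ∈ integralCombinations M H := by
  refine ⟨fun i => hH a (J i), fun j => ⟨A a j, ?_⟩⟩
  have := congrFun (congrFun hA a) j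
  simpa [Matrix.mul_apply] using! this.symm

theorem map_intCast_injective {p n : ℕ} :
    Function.Injective fun A : Matrix (Fin p) (Fin n) ℤ => A.map (Int.cast : ℤ → ℚ) :=
  Matrix.map_injective Int.cast_injective

/-- Katznelson's bound, up to `Hᵋ`, for the number of integer matrices of given rank. -/
theorem exists_ncard_rank_eq_le (n r : ℕ) {ε : ℝ} (hε : 0 < ε) :
    ∃ C : ℝ, 0 < C ∧ ∀ H : ℕ, 1 ≤ H →
      ({A ∈ boundedMatrices n H | (A.map (Int.cast : ℤ → ℚ)).rank = r}.ncard : ℝ) ≤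
        C * (H : ℝ) ^ ((n : ℝ) * r + ε) := by
  classical
  obtain ⟨C, hC, hbound⟩ := exists_relationBound_le r n hε
  refine ⟨((n : ℝ) ^ r * (3 ^ n) ^ r + 1) * C, by positivity, fun H hH => ?_⟩
  have hfin : {A ∈ boundedMatrices n H | (A.map (Int.cast : ℤ → ℚ)).rank = r}.Finite :=
    (boundedMatrices_finite n H).subset fun _ h => h.1
  set α := {A ∈ boundedMatrices n H | (A.map (Int.cast : ℤ → ℚ)).rank = r} with hα
  have : Fintype α := hfin.fintype
  choose e J M h1 h2 h3 h4 using fun a : α => exists_row_factorization a.2.2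
  have hrow : ∀ (a : α) i, a.1.submatrix id (J a) i ∈ integralCombinations (M a) H := fun a =>
    mem_integralCombinations_of_eq_mul (h4 a) a.2.1
  have key := card_le_of_card_fiber_le (H := H) J M h2 h3
    (fun a => ⟨_, h1 a, fun i => hrow a (e a i)⟩) (by
      intro b S' hS'
      have hcard : (Fintype.piFinset fun _ : Fin n =>
          (finite_integralCombinations (M b) H).toFinset).card =
          (integralCombinations (M b) H).ncard ^ n := by
        rw [Fintype.card_piFinset, Finset.prod_const, Finset.card_univ, Fintype.card_fin,
          Set.ncard_eq_toFinset_card _ (finite_integralCombinations (M b) H)]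
      rw [← hcard]
      refine Finset.card_le_card_of_injOn (fun (a : α) i j => a.1 i (J b j)) ?_ ?_
      · intro a ha
        refine Finset.mem_coe.2 (Fintype.mem_piFinset.2 fun i => ?_)
        obtain ⟨hJ, hM⟩ := hS' a ha
        rw [Set.Finite.mem_toFinset, ← hJ, ← hM]
        exact hrow a i
      · intro a ha a' ha' haa
        have haa' : a.1.submatrix id (J b) = a'.1.submatrix id (J b) :=
          Matrix.ext fun i j => congrFun (congrFun haa i) j
        obtain ⟨hJ, hM⟩ := hS' a ha
        obtain ⟨hJ', hM'⟩ := hS' a' ha'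
        refine Subtype.ext (map_intCast_injective ?_)
        dsimp only
        rw [h4 a, h4 a', hJ, hJ', hM, hM', haa'])
  rw [← Nat.card_coe_set_eq, Nat.card_eq_fintype_card]
  refine key.trans ?_
  rw [mul_assoc _ C]
  exact mul_le_mul (by linarith) (hbound H hH) (relationBound_nonneg _ _ _) (by positivity)

theorem linearIndependent_rows_castSucc_of_det_ne_zero {r : ℕ}
    {A : Matrix (Fin (r + 1)) (Fin (r + 1)) ℤ} (hA : A.det ≠ 0) :
    LinearIndependent ℚ ((A.submatrix Fin.castSucc id).map (Int.cast : ℤ → ℚ)).row := by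
  have h1 : IsUnit (A.map (Int.cast : ℤ → ℚ)) := by
    rw [Matrix.isUnit_iff_isUnit_det, isUnit_iff_ne_zero]
    have : (A.map (Int.cast : ℤ → ℚ)).det = ((A.det : ℤ) : ℚ) := (Int.cast_det A).symm
    rw [this]
    exact_mod_cast hA
  have h2 := Matrix.linearIndependent_rows_iff_isUnit.2 h1
  exact h2.comp Fin.castSucc (Fin.castSucc_injective r)

/-- Two matrices with the same determinant `d ≠ 0` and the same rows except the last have last
rows that differ by a vector in the span of the other rows. -/
theorem sub_last_row_eq_of_det_eq {r : ℕ} {A B : Matrix (Fin (r + 1)) (Fin (r + 1)) ℤ}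
    (hA : A.det ≠ 0) (hdet : A.det = B.det)
    (hrows : A.submatrix Fin.castSucc id = B.submatrix Fin.castSucc id)
    {J : Fin r → Fin (r + 1)} {M : Matrix (Fin r) (Fin (r + 1)) ℚ}
    (hM : (A.submatrix Fin.castSucc id).map (Int.cast : ℤ → ℚ) =
      (A.submatrix Fin.castSucc J).map (Int.cast : ℤ → ℚ) * M) (j : Fin (r + 1)) :
    ∑ i, (((A (Fin.last r) (J i) - B (Fin.last r) (J i) : ℤ)) : ℚ) * M i j =
      ((A (Fin.last r) j - B (Fin.last r) j : ℤ) : ℚ) := by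
  set u : Fin (r + 1) → ℤ := A (Fin.last r) - B (Fin.last r) with hu
  set R : Matrix (Fin r) (Fin (r + 1)) ℚ := (A.submatrix Fin.castSucc id).map (Int.cast : ℤ → ℚ)
    with hR
  have hli : LinearIndependent ℚ R.row := linearIndependent_rows_castSucc_of_det_ne_zero hA
  have hB : A.updateRow (Fin.last r) (B (Fin.last r)) = B := by
    ext i j
    refine Fin.lastCases ?_ (fun i => ?_) i
    · simp
    · rw [Matrix.updateRow_ne (Fin.castSucc_lt_last i).ne]
      exact congrFun (congrFun hrows i) j
  have hdetu : (A.updateRow (Fin.last r) u).det = 0 := by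
    have h := A.det_updateRow_add (Fin.last r) u (B (Fin.last r))
    rw [hB, hu, sub_add_cancel, Matrix.updateRow_eq_self, hdet] at h
    linarith
  have hmem : (fun j => (u j : ℚ)) ∈ Submodule.span ℚ (Set.range R.row) := by
    by_contra hnot
    have h1 := linearIndependent_finSnoc.2 ⟨hli, hnot⟩
    have h2 : (Fin.snoc R.row (fun j => (u j : ℚ)) : Fin (r + 1) → Fin (r + 1) → ℚ) =
        ((A.updateRow (Fin.last r) u).map (Int.cast : ℤ → ℚ)).row := by
      funext i j
      refine Fin.lastCases ?_ (fun i => ?_) i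
      · simp
      · simp [hR]
    rw [h2, Matrix.linearIndependent_rows_iff_isUnit, Matrix.isUnit_iff_isUnit_det] at h1
    have h3 : ((A.updateRow (Fin.last r) u).map (Int.cast : ℤ → ℚ)).det =
      (((A.updateRow (Fin.last r) u).det : ℤ) : ℚ) := (Int.cast_det _).symm
    rw [h3, hdetu] at h1
    simp at h1
  obtain ⟨c, hc⟩ := (Submodule.mem_span_range_iff_exists_fun ℚ).1 hmem
  have hcR : ∀ j, (u j : ℚ) = ∑ l, c l * R l j := fun j => by
    have := congrFun hc j
    simpa using this.symm
  have hRM : ∀ l j, R l j = ∑ i, R l (J i) * M i j := fun l j => by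
    have := congrFun (congrFun hM l) j
    rw [this, Matrix.mul_apply]
    rfl
  change ∑ i, ((u (J i) : ℤ) : ℚ) * M i j = (u j : ℚ)
  rw [hcR j]
  simp_rw [hcR, Finset.sum_mul]
  rw [Finset.sum_comm]
  refine Finset.sum_congr rfl fun l _ => ?_
  rw [hRM l j, Finset.mul_sum]
  exact Finset.sum_congr rfl fun i _ => by ring

/-- The number of integer matrices of given nonzero determinant, uniformly in the determinant. -/
theorem exists_ncard_det_eq_le (r : ℕ) {ε : ℝ} (hε : 0 < ε) :
    ∃ C : ℝ, 0 < C ∧ ∀ H : ℕ, 1 ≤ H → ∀ d : ℤ, d ≠ 0 →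
      ({A ∈ boundedMatrices (r + 1) H | A.det = d}.ncard : ℝ) ≤
        C * (H : ℝ) ^ (((r + 1 : ℕ) : ℝ) * r + ε) := by
  classical
  obtain ⟨C, hC, hbound⟩ := exists_relationBound_le r (r + 1) hε
  refine ⟨(((r + 1 : ℕ) : ℝ) ^ r * (3 ^ (r + 1)) ^ r + 1) * (C * 2 ^ (((r + 1 : ℕ) : ℝ) * r + ε)),
    by positivity, fun H hH d hd => ?_⟩
  have hfin : {A ∈ boundedMatrices (r + 1) H | A.det = d}.Finite :=
    (boundedMatrices_finite (r + 1) H).subset fun _ h => h.1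
  set α := {A ∈ boundedMatrices (r + 1) H | A.det = d} with hα
  have : Fintype α := hfin.fintype
  have hd' : ∀ a : α, a.1.det ≠ 0 := fun a => by rw [a.2.2]; exact hd
  choose e J M h1 h2 h3 h4 using fun a : α => exists_row_factorization
    ((linearIndependent_rows_castSucc_of_det_ne_zero (hd' a)).rank_matrix.trans
      (Fintype.card_fin r))
  -- the box of size `2 H` also contains the differences of two last rows
  have hrow : ∀ (a : α) i, a.1.submatrix Fin.castSucc (J a) i ∈
      integralCombinations (M a) (2 * H) :=
    fun a i => integralCombinations_mono _ (by omega)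
      (mem_integralCombinations_of_eq_mul (h4 a) (fun i j => a.2.1 _ _) i)
  have key := card_le_of_card_fiber_le (H := 2 * H) J M h2 h3
    (fun a => ⟨_, h1 a, fun i => hrow a (e a i)⟩) (by
      intro b S' hS'
      have hcard : (Fintype.piFinset fun _ : Fin r =>
          (finite_integralCombinations (M b) (2 * H)).toFinset).card =
          (integralCombinations (M b) (2 * H)).ncard ^ r := by
        rw [Fintype.card_piFinset, Finset.prod_const, Finset.card_univ, Fintype.card_fin,
          Set.ncard_eq_toFinset_card _ (finite_integralCombinations (M b) (2 * H))]
      rw [pow_succ', ← hcard]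
      -- the rows except the last determine the matrix up to the choice of a vector of the lattice
      refine Finset.card_le_mul_card_image_of_maps_to
        (f := fun (a : α) (i : Fin r) j => a.1 i.castSucc (J b j)) ?_ _ ?_
      · intro a ha
        refine Fintype.mem_piFinset.2 fun i => ?_
        obtain ⟨hJ, hM⟩ := hS' a ha
        rw [Set.Finite.mem_toFinset, ← hJ, ← hM]
        exact hrow a i
      · intro R _
        rcases (S'.filter fun a : α =>
            (fun (i : Fin r) j => a.1 i.castSucc (J b j)) = R).eq_empty_or_nonempty with
          hemp | ⟨a₀, ha₀⟩
        · rw [hemp]; simp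
        obtain ⟨ha₀S, ha₀R⟩ := Finset.mem_filter.1 ha₀
        obtain ⟨hJ₀, hM₀⟩ := hS' a₀ ha₀S
        have hrows : ∀ a ∈ S', (fun (i : Fin r) j => a.1 i.castSucc (J b j)) = R →
            a.1.submatrix Fin.castSucc id = a₀.1.submatrix Fin.castSucc id := by
          intro a ha haR
          obtain ⟨hJ, hM⟩ := hS' a ha
          refine map_intCast_injective ?_
          dsimp only
          rw [h4 a, h4 a₀, hJ, hJ₀, hM, hM₀]
          congr 2
          exact Matrix.ext fun i j => congrFun (congrFun (haR.trans ha₀R.symm) i) j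
        have hdiff : ∀ a ∈ S', (fun (i : Fin r) j => a.1 i.castSucc (J b j)) = R → ∀ j,
            ∑ i, (((a.1 (Fin.last r) (J b i) - a₀.1 (Fin.last r) (J b i) : ℤ)) : ℚ) * M b i j =
              ((a.1 (Fin.last r) j - a₀.1 (Fin.last r) j : ℤ) : ℚ) := by
          intro a ha haR j
          obtain ⟨hJ, hM⟩ := hS' a ha
          exact sub_last_row_eq_of_det_eq (hd' a) (a.2.2.trans a₀.2.2.symm) (hrows a ha haR)
            (by rw [← hJ, ← hM]; exact h4 a) j
        rw [Set.ncard_eq_toFinset_card _ (finite_integralCombinations (M b) (2 * H))]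
        refine Finset.card_le_card_of_injOn
          (fun a : α => fun i => a.1 (Fin.last r) (J b i) - a₀.1 (Fin.last r) (J b i)) ?_ ?_
        · intro a ha
          obtain ⟨haS, haR⟩ := Finset.mem_filter.1 ha
          rw [Set.Finite.coe_toFinset]
          refine ⟨fun i => ?_, fun j => ⟨_, hdiff a haS haR j⟩⟩
          have e1 := a.2.1 (Fin.last r) (J b i)
          have e2 := a₀.2.1 (Fin.last r) (J b i)
          rw [abs_le] at e1 e2 ⊢
          push_cast
          constructor <;> linarith
        · intro a ha a' ha' haa
          obtain ⟨haS, haR⟩ := Finset.mem_filter.1 ha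
          obtain ⟨haS', haR'⟩ := Finset.mem_filter.1 ha'
          refine Subtype.ext (Matrix.ext fun i j => ?_)
          refine Fin.lastCases ?_ (fun i => ?_) i
          · have g1 := hdiff a haS haR j
            have g2 := hdiff a' haS' haR' j
            have g3 : ∀ i, a.1 (Fin.last r) (J b i) - a₀.1 (Fin.last r) (J b i) =
              a'.1 (Fin.last r) (J b i) - a₀.1 (Fin.last r) (J b i) := fun i => congrFun haa i
            simp_rw [g3] at g1
            rw [g1] at g2
            have g4 : a.1 (Fin.last r) j - a₀.1 (Fin.last r) j =
              a'.1 (Fin.last r) j - a₀.1 (Fin.last r) j := by exact_mod_cast g2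
            linarith
          · exact congrFun (congrFun ((hrows a haS haR).trans (hrows a' haS' haR').symm) i) j)
  rw [← Nat.card_coe_set_eq, Nat.card_eq_fintype_card]
  refine key.trans ?_
  have hb := hbound (2 * H) (by omega)
  rw [Nat.cast_mul, Nat.cast_ofNat, Real.mul_rpow (by norm_num) (by positivity), ← mul_assoc] at hb
  rw [mul_assoc _ (C * _)]
  exact mul_le_mul (by linarith) hb (relationBound_nonneg _ _ _) (by positivity)

/-! ### The divisor bound -/

theorem factor_le_mul_rpow {ε : ℝ} (hε : 0 < ε) {x : ℝ} (hx : 2 ≤ x) (a : ℕ) :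
    (a : ℝ) + 1 ≤ (1 + 1 / (ε * Real.log 2)) * (x ^ a) ^ ε := by
  have hlog : 0 < Real.log 2 := Real.log_pos (by norm_num)
  have h1 : 1 + a * (ε * Real.log 2) ≤ (x ^ a) ^ ε := by
    have h2 : (2 : ℝ) ^ (a * ε) ≤ (x ^ a) ^ ε := by
      rw [Real.rpow_mul (by norm_num), Real.rpow_natCast]
      gcongr
    refine le_trans ?_ h2
    rw [Real.rpow_def_of_pos (by norm_num)]
    have := Real.add_one_le_exp (Real.log 2 * (a * ε))
    linarith
  calc (a : ℝ) + 1 ≤ (1 + 1 / (ε * Real.log 2)) * (1 + a * (ε * Real.log 2)) := by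
        have : (1 + 1 / (ε * Real.log 2)) * (1 + a * (ε * Real.log 2)) =
          1 + a + (a * (ε * Real.log 2) + 1 / (ε * Real.log 2)) := by
          field_simp
          ring
        rw [this]
        have : 0 ≤ a * (ε * Real.log 2) + 1 / (ε * Real.log 2) := by positivity
        linarith
    _ ≤ _ := by gcongr

/-- The divisor bound `τ(N) = O(Nᵋ)`. Only the primes with `pᵋ < 2` contribute to the constant. -/
theorem exists_card_divisors_le {ε : ℝ} (hε : 0 < ε) :
    ∃ C : ℝ, 0 < C ∧ ∀ N : ℕ, N ≠ 0 → (N.divisors.card : ℝ) ≤ C * (N : ℝ) ^ ε := by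
  classical
  set K : ℝ := 1 + 1 / (ε * Real.log 2) with hK
  set P : ℕ := ⌈(2 : ℝ) ^ (1 / ε)⌉₊ with hP
  have hlog : 0 < Real.log 2 := Real.log_pos (by norm_num)
  have hK1 : 1 ≤ K := by
    have : 0 ≤ 1 / (ε * Real.log 2) := by positivity
    linarith
  refine ⟨K ^ P, by positivity, fun N hN => ?_⟩
  have hfac : ∀ p ∈ N.primeFactors, ((N.factorization p : ℝ) + 1) ≤
      (if p < P then K else 1) * (((p : ℝ) ^ N.factorization p)) ^ ε := by
    intro p hp
    have hp2 : (2 : ℝ) ≤ p := by exact_mod_cast (Nat.prime_of_mem_primeFactors hp).two_le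
    split_ifs with h
    · exact factor_le_mul_rpow hε hp2 _
    · have h1 : (2 : ℝ) ≤ (p : ℝ) ^ ε := by
        have h2 : (2 : ℝ) ^ (1 / ε) ≤ p := (Nat.le_ceil _).trans (by exact_mod_cast not_lt.1 h)
        calc (2 : ℝ) = ((2 : ℝ) ^ (1 / ε)) ^ ε := by
              rw [← Real.rpow_mul (by norm_num), one_div_mul_cancel hε.ne', Real.rpow_one]
          _ ≤ _ := by gcongr
      rw [one_mul, ← Real.rpow_pow_comm (by positivity)]
      calc ((N.factorization p : ℝ) + 1) ≤ 2 ^ N.factorization p := by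
            exact_mod_cast Nat.lt_two_pow_self
        _ ≤ _ := by gcongr
  have hprod : (N : ℝ) = ∏ p ∈ N.primeFactors, (p : ℝ) ^ N.factorization p := by
    have := Nat.prod_factorization_pow_eq_self hN
    rw [Finsupp.prod, Nat.support_factorization] at this
    exact_mod_cast this.symm
  calc (N.divisors.card : ℝ) = ∏ p ∈ N.primeFactors, ((N.factorization p : ℝ) + 1) := by
        rw [Nat.card_divisors hN]; push_cast; rfl
    _ ≤ ∏ p ∈ N.primeFactors, (if p < P then K else 1) * ((p : ℝ) ^ N.factorization p) ^ ε :=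
        Finset.prod_le_prod (fun _ _ => by positivity) hfac
    _ = (∏ p ∈ N.primeFactors, if p < P then K else 1) * (N : ℝ) ^ ε := by
        rw [Finset.prod_mul_distrib, Real.finsetProd_rpow _ _ (fun _ _ => by positivity), ← hprod]
    _ ≤ _ := by
        gcongr
        rw [Finset.prod_ite, Finset.prod_const, Finset.prod_const_one, mul_one]
        refine pow_le_pow_right₀ hK1 ?_
        calc _ ≤ (Finset.range P).card := Finset.card_le_card fun p hp => by
              simpa using (Finset.mem_filter.1 hp).2
          _ = P := Finset.card_range P

/-! ### Coranks of products -/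

/-- The corank of an integer matrix over `ℚ`; the subtraction does not truncate. -/
noncomputable def corank {n : ℕ} (A : Matrix (Fin n) (Fin n) ℤ) : ℕ :=
  n - (A.map (Int.cast : ℤ → ℚ)).rank

/-- Sylvester's rank inequality. -/
theorem rank_add_rank_le_card_add_rank_mul {K l m n : Type*} [Field K] [Fintype l] [Fintype m]
    [Fintype n] (A : Matrix l m K) (B : Matrix m n K) :
    A.rank + B.rank ≤ Fintype.card m + (A * B).rank := by
  set f := A.mulVecLin
  set g := B.mulVecLin
  have h1 := (f.domRestrict (LinearMap.range g)).finrank_range_add_finrank_ker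
  have h2 : LinearMap.range (f.domRestrict (LinearMap.range g)) = LinearMap.range (f ∘ₗ g) := by
    rw [LinearMap.range_domRestrict, LinearMap.range_comp]
  have h3 : Module.finrank K (LinearMap.ker (f.domRestrict (LinearMap.range g))) ≤
      Module.finrank K (LinearMap.ker f) := by
    refine LinearMap.finrank_le_finrank_of_injective
      (f := ((LinearMap.range g).subtype.domRestrict _).codRestrict (LinearMap.ker f)
        fun x => LinearMap.mem_ker.1 x.2) ?_
    intro x y h
    have : ((x : LinearMap.range g) : m → K) = (y : LinearMap.range g) :=
      congrArg (fun z : LinearMap.ker f => (z : m → K)) h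
    exact Subtype.ext (Subtype.ext this)
  have h4 := f.finrank_range_add_finrank_ker
  have h5 : (A * B).rank = Module.finrank K (LinearMap.range (f ∘ₗ g)) := by
    rw [Matrix.rank, Matrix.mulVecLin_mul]
  have h6 : A.rank = Module.finrank K (LinearMap.range f) := rfl
  have h7 : B.rank = Module.finrank K (LinearMap.range g) := rfl
  rw [Module.finrank_fintype_fun_eq_card] at h4
  rw [h2] at h1
  omega

theorem corank_mul_le {n : ℕ} (A B : Matrix (Fin n) (Fin n) ℤ) :
    corank (A * B) ≤ corank A + corank B := by
  have h := rank_add_rank_le_card_add_rank_mul (A.map (Int.cast : ℤ → ℚ))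
    (B.map (Int.cast : ℤ → ℚ))
  have hAB : (A * B).map (Int.cast : ℤ → ℚ) =
      A.map (Int.cast : ℤ → ℚ) * B.map (Int.cast : ℤ → ℚ) :=
    Matrix.map_mul (f := Int.castRingHom ℚ)
  have hA := (A.map (Int.cast : ℤ → ℚ)).rank_le_width
  have hB := (B.map (Int.cast : ℤ → ℚ)).rank_le_width
  unfold corank
  rw [hAB]
  rw [Fintype.card_fin] at h
  omega

theorem corank_prod_le {n k : ℕ} (B : Fin k → Matrix (Fin n) (Fin n) ℤ) :
    corank (List.ofFn B).prod ≤ ∑ i, corank (B i) := by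
  induction k with
  | zero => simp [corank, Matrix.map_one, Matrix.rank_one]
  | succ k ih =>
    rw [List.ofFn_succ, List.prod_cons, Fin.sum_univ_succ]
    exact (corank_mul_le _ _).trans (by gcongr; exact ih _)

/-- For given `P`, a solution `A` of `A P = C` is determined by its columns outside a set of
`rank P` indices of linearly independent rows of `P`. -/
theorem ncard_mul_eq_le (n H : ℕ) (P C : Matrix (Fin n) (Fin n) ℤ) :
    {A ∈ boundedMatrices n H | A * P = C}.ncard ≤ (2 * H + 1) ^ (n * corank P) := by
  classical
  set Q : Matrix (Fin n) (Fin n) ℚ := P.map (Int.cast : ℤ → ℚ) with hQ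
  obtain ⟨e, he⟩ := exists_linearIndependent_cols (A := Qᵀ) (r := Q.rank) (Matrix.rank_transpose Q)
  have hinj : Function.Injective e := fun i j hij => he.injective (by
    funext l; simp [hij])
  set ι := Fin n × {j : Fin n // j ∉ Set.range e}
  have hι : Fintype.card ι = n * corank P := by
    rw [Fintype.card_prod, Fintype.card_fin]
    congr 1
    have h1 := Fintype.card_subtype_compl fun j => j ∈ Set.range e
    have h2 : Fintype.card {j // j ∈ Set.range e} = Q.rank := by
      rw [← Fintype.card_congr (Equiv.ofInjective e hinj), Fintype.card_fin]
    rw [h2, Fintype.card_fin] at h1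
    exact h1
  rw [← hι, ← ncard_box]
  refine Set.ncard_le_ncard_of_injOn (fun A => fun p : ι => A p.1 p.2) ?_ ?_ (finite_box ι H)
  · intro A hA p
    exact hA.1 _ _
  · intro A hA B hB hAB
    have hout : ∀ i, ∀ j, j ∉ Set.range e → A i j = B i j := fun i j hj =>
      congrFun hAB (i, ⟨j, hj⟩)
    have hin : ∀ i l, A i (e l) - B i (e l) = 0 := by
      intro i
      have hsum : ∑ l, ((A i (e l) - B i (e l) : ℤ) : ℚ) • (Qᵀ.submatrix id e).col l = 0 := by
        funext j
        have h1 : ∑ s, (A i s - B i s) * P s j = 0 := by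
          have h2 : (A * P) i j = (B * P) i j := by rw [hA.2, hB.2]
          simp only [Matrix.mul_apply] at h2
          simp only [sub_mul, Finset.sum_sub_distrib, h2, sub_self]
        have h3 : ∑ l, (A i (e l) - B i (e l)) * P (e l) j = 0 := by
          rw [← h1, ← Finset.sum_image (s := Finset.univ) (g := e)
            (f := fun s => (A i s - B i s) * P s j) hinj.injOn]
          refine Finset.sum_subset (Finset.subset_univ _) fun s _ hs => ?_
          rw [hout i s fun ⟨l, hl⟩ => hs (Finset.mem_image.2 ⟨l, Finset.mem_univ _, hl⟩)]
          simp
        have h4 : ((∑ l, (A i (e l) - B i (e l)) * P (e l) j : ℤ) : ℚ) = 0 := by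
          rw [h3]; simp
        simpa [hQ] using! h4
      intro l
      exact_mod_cast Fintype.linearIndependent_iff.1 he _ hsum l
    ext i j
    by_cases hj : j ∈ Set.range e
    · obtain ⟨l, rfl⟩ := hj
      exact sub_eq_zero.1 (hin i l)
    · exact hout i j hj

/-- In the sum over all matrices every rank `r` contributes `H ^ (n r) · H ^ (n (n - r))`, up to
`Hᵋ`. -/
theorem exists_sum_pow_corank_le (n : ℕ) {ε : ℝ} (hε : 0 < ε) :
    ∃ C : ℝ, 0 < C ∧ ∀ H : ℕ, 1 ≤ H →
      ∑ A ∈ (boundedMatrices_finite n H).toFinset, ((2 * H + 1 : ℕ) : ℝ) ^ (n * corank A) ≤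
        C * (H : ℝ) ^ ((n : ℝ) ^ 2 + ε) := by
  classical
  choose C hC hbound using fun r : ℕ => exists_ncard_rank_eq_le n r hε
  refine ⟨∑ r ∈ Finset.range (n + 1), C r * 3 ^ (n * (n - r)),
    Finset.sum_pos (fun r _ => mul_pos (hC r) (by positivity)) (by simp), fun H hH => ?_⟩
  have hH1 : (1 : ℝ) ≤ H := by exact_mod_cast hH
  set S := (boundedMatrices_finite n H).toFinset with hS
  rw [← Finset.sum_fiberwise_of_maps_to (s := S) (t := Finset.range (n + 1))
    (g := fun A => (A.map (Int.cast : ℤ → ℚ)).rank) (fun A _ =>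
      Finset.mem_range.2 (Nat.lt_succ_of_le (Matrix.rank_le_width _))), Finset.sum_mul]
  refine Finset.sum_le_sum fun r hr => ?_
  have hrn : r ≤ n := Nat.lt_succ_iff.1 (Finset.mem_range.1 hr)
  have hcard : ((S.filter fun A => (A.map (Int.cast : ℤ → ℚ)).rank = r).card : ℝ) ≤
      C r * (H : ℝ) ^ ((n : ℝ) * r + ε) := by
    have : {A ∈ boundedMatrices n H | (A.map (Int.cast : ℤ → ℚ)).rank = r} =
        ↑(S.filter fun A => (A.map (Int.cast : ℤ → ℚ)).rank = r) := by
      ext A; simp [hS]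
    have h := hbound r H hH
    rwa [this, Set.ncard_coe_finset] at h
  calc _ = ∑ A ∈ S.filter fun A => (A.map (Int.cast : ℤ → ℚ)).rank = r,
        ((2 * H + 1 : ℕ) : ℝ) ^ (n * (n - r)) :=
        Finset.sum_congr rfl fun A hA => by rw [corank, (Finset.mem_filter.1 hA).2]
    _ = ((S.filter fun A => (A.map (Int.cast : ℤ → ℚ)).rank = r).card : ℝ) *
        ((2 * H + 1 : ℕ) : ℝ) ^ (n * (n - r)) := by rw [Finset.sum_const, nsmul_eq_mul]
    _ ≤ (C r * (H : ℝ) ^ ((n : ℝ) * r + ε)) * (3 * H) ^ (n * (n - r)) := by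
        gcongr
        · have := (hC r).le
          positivity
        · push_cast
          linarith
    _ = C r * 3 ^ (n * (n - r)) * ((H : ℝ) ^ ((n : ℝ) * r + ε) * (H : ℝ) ^ (n * (n - r))) := by
        rw [mul_pow]; ring
    _ = _ := by
        rw [← Real.rpow_natCast (H : ℝ), ← Real.rpow_add (by positivity)]
        congr 2
        push_cast [Nat.cast_sub hrn]
        ring

/-! ### Tuples with a given product -/

theorem ofFn_prod_eq {n k : ℕ} (A : Fin (k + 1) → Matrix (Fin n) (Fin n) ℤ) :
    (List.ofFn A).prod = A 0 * (List.ofFn fun i => A i.succ).prod := by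
  rw [List.ofFn_succ, List.prod_cons]

/-- Given the last `k` factors with product `P`, the first one has `n · corank P` free entries, and
coranks are subadditive. The sum over all `k`-tuples of factors is then a `k`-th power. -/
theorem ncard_productTuples_succ_le (n k H : ℕ) (C : Matrix (Fin n) (Fin n) ℤ) :
    ((productTuples (k + 1) (boundedMatrices n H) C).ncard : ℝ) ≤
      (∑ A ∈ (boundedMatrices_finite n H).toFinset,
        ((2 * H + 1 : ℕ) : ℝ) ^ (n * corank A)) ^ k := by
  classical
  set S := (boundedMatrices_finite n H).toFinset with hS
  set F := (productTuples_finite (k + 1) n H C).toFinset with hF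
  rw [Set.ncard_eq_toFinset_card _ (productTuples_finite (k + 1) n H C)]
  have hmaps : ∀ A ∈ F, (fun i : Fin k => A i.succ) ∈ Fintype.piFinset fun _ : Fin k => S := by
    intro A hA
    rw [Fintype.mem_piFinset]
    intro i
    rw [hS, Set.Finite.mem_toFinset]
    exact ((Set.Finite.mem_toFinset _).1 hA).1 _
  rw [Finset.card_eq_sum_card_fiberwise hmaps]
  push_cast
  calc _ ≤ ∑ B ∈ Fintype.piFinset fun _ : Fin k => S,
        ∏ i, ((2 * H + 1 : ℕ) : ℝ) ^ (n * corank (B i)) := by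
        refine Finset.sum_le_sum fun B _ => ?_
        have h1 : (F.filter fun A => (fun i : Fin k => A i.succ) = B).card ≤
            (2 * H + 1) ^ (n * corank (List.ofFn B).prod) := by
          refine le_trans ?_ (ncard_mul_eq_le n H (List.ofFn B).prod C)
          rw [← Set.ncard_coe_finset]
          refine Set.ncard_le_ncard_of_injOn (fun A => A 0) ?_ ?_
            ((boundedMatrices_finite n H).subset fun _ h => h.1)
          · intro A hA
            obtain ⟨hA1, hA2⟩ := Finset.mem_filter.1 (Finset.mem_coe.1 hA)
            obtain ⟨h1, h2⟩ := (Set.Finite.mem_toFinset _).1 hA1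
            refine ⟨h1 0, ?_⟩
            rw [← hA2, ← ofFn_prod_eq, h2]
          · intro A hA A' hA' hAA
            obtain ⟨hA1, hA2⟩ := Finset.mem_filter.1 (Finset.mem_coe.1 hA)
            obtain ⟨hA1', hA2'⟩ := Finset.mem_filter.1 (Finset.mem_coe.1 hA')
            funext i
            refine Fin.cases hAA (fun i => ?_) i
            exact congrFun (hA2.trans hA2'.symm) i
        have h2 : (2 * H + 1) ^ (n * corank (List.ofFn B).prod) ≤
            ∏ i, (2 * H + 1) ^ (n * corank (B i)) := by
          rw [Finset.prod_pow_eq_pow_sum, ← Finset.mul_sum]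
          exact Nat.pow_le_pow_right (by omega) (Nat.mul_le_mul_left n (corank_prod_le B))
        exact_mod_cast h1.trans h2
    _ = _ := by
        rw [← Finset.prod_univ_sum (fun _ : Fin k => S)
          fun _ A => ((2 * H + 1 : ℕ) : ℝ) ^ (n * corank A)]
        simp

theorem abs_det_le_of_mem_boundedMatrices {n H : ℕ} {A : Matrix (Fin n) (Fin n) ℤ}
    (hA : A ∈ boundedMatrices n H) : |A.det| ≤ (n.factorial : ℤ) * (H : ℤ) ^ n := by
  have := Matrix.det_le (A := A) (abv := AbsoluteValue.abs) (x := (H : ℤ)) hA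
  simpa using this

theorem det_ofFn_prod {n k : ℕ} (A : Fin k → Matrix (Fin n) (Fin n) ℤ) :
    (List.ofFn A).prod.det = ∏ i, (A i).det := by
  induction k with
  | zero => simp
  | succ k ih => rw [ofFn_prod_eq, Matrix.det_mul, ih, Fin.prod_univ_succ]

theorem natAbs_det_le_of_mem_productTuples {n m H : ℕ} {C : Matrix (Fin n) (Fin n) ℤ}
    {A : Fin m → Matrix (Fin n) (Fin n) ℤ} (hA : A ∈ productTuples m (boundedMatrices n H) C) :
    C.det.natAbs ≤ (n.factorial * H ^ n) ^ m := by
  have h : |C.det| ≤ (((n.factorial * H ^ n) ^ m : ℕ) : ℤ) := by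
    rw [← hA.2, det_ofFn_prod, Finset.abs_prod]
    calc _ ≤ ∏ i : Fin m, ((n.factorial : ℤ) * (H : ℤ) ^ n) :=
          Finset.prod_le_prod (fun _ _ => abs_nonneg _) fun i _ =>
            abs_det_le_of_mem_boundedMatrices (hA.1 i)
      _ = _ := by simp
  rw [Int.abs_eq_natAbs] at h
  exact_mod_cast h

theorem card_filter_det_dvd_le {n H : ℕ} {D : ℤ} (hD : D ≠ 0) {B : ℝ}
    (hB : ∀ d : ℤ, d ≠ 0 → ({A ∈ boundedMatrices n H | A.det = d}.ncard : ℝ) ≤ B) :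
    (((boundedMatrices_finite n H).toFinset.filter fun A => A.det ∣ D).card : ℝ) ≤
      2 * D.natAbs.divisors.card * B := by
  classical
  set S := (boundedMatrices_finite n H).toFinset with hS
  set T : Finset ℤ := D.natAbs.divisors.image (fun d : ℕ => (d : ℤ)) ∪
    D.natAbs.divisors.image (fun d : ℕ => -(d : ℤ)) with hT
  have hB0 : 0 ≤ B := (Nat.cast_nonneg _).trans (hB D hD)
  have hTcard : T.card ≤ 2 * D.natAbs.divisors.card := by
    refine (Finset.card_union_le _ _).trans ?_
    rw [two_mul]
    exact Nat.add_le_add Finset.card_image_le Finset.card_image_le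
  have hmaps : ∀ A ∈ S.filter fun A => A.det ∣ D, A.det ∈ T := by
    intro A hA
    have h1 : A.det.natAbs ∈ D.natAbs.divisors :=
      Nat.mem_divisors.2 ⟨Int.natAbs_dvd_natAbs.2 (Finset.mem_filter.1 hA).2, by simpa⟩
    rcases Int.natAbs_eq A.det with h | h
    · exact Finset.mem_union_left _ (Finset.mem_image.2 ⟨_, h1, h.symm⟩)
    · exact Finset.mem_union_right _ (Finset.mem_image.2 ⟨_, h1, h.symm⟩)
  rw [Finset.card_eq_sum_card_fiberwise hmaps]
  push_cast
  calc _ ≤ ∑ d ∈ T, B := by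
        refine Finset.sum_le_sum fun d hd => ?_
        have hd0 : d ≠ 0 := by
          rintro rfl
          simp [hT] at hd
        refine le_trans ?_ (hB d hd0)
        rw [← Set.ncard_coe_finset]
        refine Nat.cast_le.2 (Set.ncard_le_ncard ?_
          ((boundedMatrices_finite n H).subset fun _ h => h.1))
        intro A hA
        simp only [Finset.coe_filter, Finset.mem_filter, Set.mem_ofPred_eq, hS,
          Set.Finite.mem_toFinset] at hA
        exact ⟨hA.1.1, hA.2⟩
    _ = T.card * B := by rw [Finset.sum_const, nsmul_eq_mul]
    _ ≤ _ := by
        gcongr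
        exact_mod_cast hTcard

theorem eq_of_mul_eq_mul_of_det_ne_zero {n : ℕ} {A B P : Matrix (Fin n) (Fin n) ℤ}
    (hP : P.det ≠ 0) (h : A * P = B * P) : A = B := by
  have h1 : A * P * P.adjugate = B * P * P.adjugate := by rw [h]
  rw [Matrix.mul_assoc, Matrix.mul_assoc, Matrix.mul_adjugate, Matrix.mul_smul, Matrix.mul_smul,
    Matrix.mul_one, Matrix.mul_one] at h1
  exact smul_right_injective _ hP h1

theorem ncard_productTuples_le_of_det_ne_zero {n k H : ℕ} {C : Matrix (Fin n) (Fin n) ℤ}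
    (hC : C.det ≠ 0) :
    (productTuples (k + 1) (boundedMatrices n H) C).ncard ≤
      ((boundedMatrices_finite n H).toFinset.filter fun A => A.det ∣ C.det).card ^ k := by
  classical
  set S := (boundedMatrices_finite n H).toFinset.filter fun A => A.det ∣ C.det with hS
  have hcard : (Fintype.piFinset fun _ : Fin k => S).card = S.card ^ k := by simp
  rw [← hcard, ← Set.ncard_coe_finset]
  refine Set.ncard_le_ncard_of_injOn (fun A (i : Fin k) => A i.succ) ?_ ?_ (Finset.finite_toSet _)
  · intro A hA
    refine Finset.mem_coe.2 (Fintype.mem_piFinset.2 fun i => ?_)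
    rw [hS, Finset.mem_filter, Set.Finite.mem_toFinset]
    refine ⟨hA.1 _, ?_⟩
    rw [← hA.2, det_ofFn_prod]
    exact Finset.dvd_prod_of_mem (fun i => (A i).det) (Finset.mem_univ i.succ)
  · intro A hA B hB hAB
    have hprod : A 0 * (List.ofFn fun i => A i.succ).prod =
        B 0 * (List.ofFn fun i => A i.succ).prod := by
      have hAB' : (fun i : Fin k => A i.succ) = fun i => B i.succ := hAB
      rw [← ofFn_prod_eq, hAB', ← ofFn_prod_eq, hA.2, hB.2]
    have hP : (List.ofFn fun i => A i.succ).prod.det ≠ 0 := by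
      intro h0
      apply hC
      rw [← hA.2, ofFn_prod_eq, Matrix.det_mul, h0, mul_zero]
    funext i
    exact Fin.cases (eq_of_mul_eq_mul_of_det_ne_zero hP hprod) (fun i => congrFun hAB i) i

/-- The count for nonsingular `C`: all factors but one have a determinant dividing `det C`, and
they determine the remaining one. -/
theorem exists_ncard_productTuples_le_of_det_ne_zero (r k : ℕ) {ε : ℝ} (hε : 0 < ε) :
    ∃ K : ℝ, 0 < K ∧ ∀ H : ℕ, 1 ≤ H → ∀ C : Matrix (Fin (r + 1)) (Fin (r + 1)) ℤ, C.det ≠ 0 →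
      ((productTuples (k + 1) (boundedMatrices (r + 1) H) C).ncard : ℝ) ≤
        K * (H : ℝ) ^ ((k : ℝ) * (((r + 1 : ℕ) : ℝ) * r) + ε) := by
  set n := r + 1 with hn
  -- for each of `k` factors, the determinant count costs `H ^ δ` and the divisor bound costs
  -- `H ^ (n (k + 1) δ)`, as `det C` may be as large as `H ^ (n (k + 1))` up to a constant
  set δ : ℝ := ε / (k * (n * (k + 1) + 1) + 1) with hδ
  have hδ0 : 0 < δ := by positivity
  obtain ⟨K₁, hK₁, hdet⟩ := exists_ncard_det_eq_le r hδ0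
  obtain ⟨K₂, hK₂, hdiv⟩ := exists_card_divisors_le hδ0
  set F : ℝ := ((n.factorial : ℝ) ^ (k + 1)) ^ δ with hF
  refine ⟨(2 * (K₂ * F) * K₁) ^ k, by positivity, fun H hH C hC => ?_⟩
  have hH1 : (1 : ℝ) ≤ H := by exact_mod_cast hH
  rcases Set.eq_empty_or_nonempty (productTuples (k + 1) (boundedMatrices n H) C) with h | ⟨A, hA⟩
  · rw [h]; simp only [Set.ncard_empty, Nat.cast_zero]; positivity
  have hτ : (C.det.natAbs.divisors.card : ℝ) ≤ K₂ * (F * (H : ℝ) ^ (n * (k + 1) * δ)) := by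
    refine (hdiv _ (by simpa using hC)).trans ?_
    have h1 : (C.det.natAbs : ℝ) ≤ ((n.factorial : ℝ) * H ^ n) ^ (k + 1) := by
      exact_mod_cast natAbs_det_le_of_mem_productTuples hA
    have h2 : (((n.factorial : ℝ) * H ^ n) ^ (k + 1)) ^ δ = F * (H : ℝ) ^ (n * (k + 1) * δ) := by
      have h3 : ((H : ℝ) ^ (n * (k + 1))) ^ δ = (H : ℝ) ^ (((n * (k + 1) : ℕ) : ℝ) * δ) :=
        (Real.rpow_natCast_mul (by positivity) _ _).symm
      rw [mul_pow, Real.mul_rpow (by positivity) (by positivity), ← pow_mul, h3]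
      push_cast
      rfl
    rw [← h2]
    gcongr
  have hcard := card_filter_det_dvd_le hC (hdet H hH)
  calc ((productTuples (k + 1) (boundedMatrices n H) C).ncard : ℝ)
      ≤ (((boundedMatrices_finite n H).toFinset.filter fun A => A.det ∣ C.det).card : ℝ) ^ k := by
        exact_mod_cast ncard_productTuples_le_of_det_ne_zero hC
    _ ≤ (2 * (K₂ * (F * (H : ℝ) ^ (n * (k + 1) * δ))) *
          (K₁ * (H : ℝ) ^ ((n : ℝ) * r + δ))) ^ k := by
        gcongr
        refine hcard.trans ?_
        gcongr
    _ = (2 * (K₂ * F) * K₁) ^ k *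
          (((H : ℝ) ^ (n * (k + 1) * δ)) * (H : ℝ) ^ ((n : ℝ) * r + δ)) ^ k := by
        rw [← mul_pow]; ring
    _ ≤ _ := by
        rw [← Real.rpow_add (by positivity), ← Real.rpow_mul_natCast (by positivity)]
        gcongr
        have h1 : k * (n * (k + 1) + 1) * δ ≤ ε := by
          rw [hδ, mul_div_assoc', div_le_iff₀ (by positivity)]
          nlinarith
        linarith

/-- The count for arbitrary `C`. -/
theorem exists_ncard_productTuples_le (n k : ℕ) {ε : ℝ} (hε : 0 < ε) :
    ∃ K : ℝ, 0 < K ∧ ∀ H : ℕ, 1 ≤ H → ∀ C : Matrix (Fin n) (Fin n) ℤ,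
      ((productTuples (k + 1) (boundedMatrices n H) C).ncard : ℝ) ≤
        K * (H : ℝ) ^ ((k : ℝ) * (n : ℝ) ^ 2 + ε) := by
  obtain ⟨K, hK, hsum⟩ := exists_sum_pow_corank_le n (ε := ε / (k + 1)) (by positivity)
  refine ⟨K ^ k, by positivity, fun H hH C => ?_⟩
  have hH1 : (1 : ℝ) ≤ H := by exact_mod_cast hH
  calc _ ≤ (K * (H : ℝ) ^ ((n : ℝ) ^ 2 + ε / (k + 1))) ^ k := by
        refine (ncard_productTuples_succ_le n k H C).trans ?_
        gcongr
        exact hsum H hH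
    _ = K ^ k * (H : ℝ) ^ (((n : ℝ) ^ 2 + ε / (k + 1)) * k) := by
        rw [mul_pow, Real.rpow_mul_natCast (by positivity)]
    _ ≤ _ := by
        gcongr
        have h1 : ε / (k + 1) * k ≤ ε := by
          rw [div_mul_eq_mul_div, div_le_iff₀ (by positivity)]
          nlinarith
        linarith

/-- A multiplicative constant is absorbed by an arbitrarily small power of `H`. -/
theorem exists_forall_mul_rpow_le (K s : ℝ) {ε : ℝ} (hε : 0 < ε) :
    ∃ H₀ : ℕ, 1 ≤ H₀ ∧ ∀ H : ℕ, H₀ ≤ H → K * (H : ℝ) ^ (s + ε / 2) ≤ (H : ℝ) ^ (s + ε) := by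
  have h := ((tendsto_rpow_atTop (half_pos hε)).comp
    tendsto_natCast_atTop_atTop).eventually_ge_atTop K
  obtain ⟨H₁, hH₁⟩ := Filter.eventually_atTop.1 h
  refine ⟨max H₁ 1, le_max_right _ _, fun H hH => ?_⟩
  have hpos : (0 : ℝ) < H := by exact_mod_cast (le_max_right _ _).trans hH
  have h1 : K ≤ (H : ℝ) ^ (ε / 2) := hH₁ H ((le_max_left _ _).trans hH)
  calc K * (H : ℝ) ^ (s + ε / 2) ≤ (H : ℝ) ^ (ε / 2) * (H : ℝ) ^ (s + ε / 2) := by gcongr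
    _ = _ := by rw [← Real.rpow_add hpos]; congr 1; ring

theorem pow_le_ncard_productTuples_zero (n k H : ℕ) :
    H ^ (k * n ^ 2) ≤ (productTuples (k + 1) (boundedMatrices n H) 0).ncard := by
  have h1 : (2 * H + 1) ^ (k * n ^ 2) ≤
      (productTuples (k + 1) (boundedMatrices n H) 0).ncard := by
    have hι : Fintype.card (Fin k × Fin n × Fin n) = k * n ^ 2 := by
      simp [sq]
    rw [← hι, ← ncard_box]
    refine Set.ncard_le_ncard_of_injOn
      (fun y => (Fin.cons 0 fun i => Matrix.of fun a b => y (i, a, b) :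
        Fin (k + 1) → Matrix (Fin n) (Fin n) ℤ)) ?_ ?_ (productTuples_finite _ _ _ _)
    · intro y hy
      refine ⟨fun i => ?_, ?_⟩
      · refine Fin.cases ?_ (fun i => ?_) i
        · intro a b; simp
        · intro a b; exact hy (i, a, b)
      · rw [ofFn_prod_eq]; simp
    · intro y _ y' _ h
      funext ⟨i, a, b⟩
      exact congrFun (congrFun (congrFun h i.succ) a) b
  exact (Nat.pow_le_pow_left (by omega) _).trans h1

theorem theorem2p1 (m n : ℕ) (hm : 1 ≤ m) (hn : 1 ≤ n) :
    -- nonsingular `C`, uniformly in `C`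
    (∀ ε : ℝ, 0 < ε → ∃ H₀ : ℕ, ∀ H : ℕ, H₀ ≤ H → ∀ C : Matrix (Fin n) (Fin n) ℤ,
      C.det ≠ 0 →
        ((productTuples m (boundedMatrices n H) C).ncard : ℝ) ≤
          (H : ℝ) ^ (((m : ℝ) - 1) * ((n : ℝ) ^ 2 - (n : ℝ)) + ε)) ∧
    -- nonzero singular `C`, two factors
    (m = 2 → ∀ ε : ℝ, 0 < ε → ∃ H₀ : ℕ, ∀ H : ℕ, H₀ ≤ H →
      ∀ C : Matrix (Fin n) (Fin n) ℤ, C.det = 0 → C ≠ 0 →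
        ((productTuples m (boundedMatrices n H) C).ncard : ℝ) ≤
          (H : ℝ) ^ ((n : ℝ) ^ 2 + ε)) ∧
    -- nonzero singular `C`, at least three factors (no loss in the exponent)
    (3 ≤ m → ∃ H₀ : ℕ, ∀ H : ℕ, H₀ ≤ H →
      ∀ C : Matrix (Fin n) (Fin n) ℤ, C.det = 0 → C ≠ 0 →
        ((productTuples m (boundedMatrices n H) C).ncard : ℝ) ≤
          (H : ℝ) ^ ((m : ℝ) * (n : ℝ) ^ 2 - (n : ℝ))) ∧
    -- zero matrix, lower bound
    (∃ c : ℝ, 0 < c ∧ ∀ H : ℕ, 1 ≤ H →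
      c * (H : ℝ) ^ (((m : ℝ) - 1) * (n : ℝ) ^ 2) ≤
        ((productTuples m (boundedMatrices n H) 0).ncard : ℝ)) ∧
    -- zero matrix, upper bound
    (∀ ε : ℝ, 0 < ε → ∃ H₀ : ℕ, ∀ H : ℕ, H₀ ≤ H →
      ((productTuples m (boundedMatrices n H) 0).ncard : ℝ) ≤
        (H : ℝ) ^ (((m : ℝ) - 1) * (n : ℝ) ^ 2 + ε)) := by
  obtain ⟨k, rfl⟩ : ∃ k, m = k + 1 := ⟨m - 1, by omega⟩
  have hk : ((k + 1 : ℕ) : ℝ) - 1 = k := by push_cast; ring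
  have hall : ∀ ε : ℝ, 0 < ε → ∃ H₀ : ℕ, 1 ≤ H₀ ∧ ∀ H : ℕ, H₀ ≤ H →
      ∀ C : Matrix (Fin n) (Fin n) ℤ,
        ((productTuples (k + 1) (boundedMatrices n H) C).ncard : ℝ) ≤
          (H : ℝ) ^ ((k : ℝ) * (n : ℝ) ^ 2 + ε) := by
    intro ε hε
    obtain ⟨K, -, hK⟩ := exists_ncard_productTuples_le n k (half_pos hε)
    obtain ⟨H₀, hH₀, h⟩ := exists_forall_mul_rpow_le K ((k : ℝ) * (n : ℝ) ^ 2) hε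
    exact ⟨H₀, hH₀, fun H hH C => (hK H (hH₀.trans hH) C).trans (h H hH)⟩
  refine ⟨fun ε hε => ?_, fun hm2 ε hε => ?_, fun hm3 => ?_, ⟨1, one_pos, fun H hH => ?_⟩,
    fun ε hε => ?_⟩
  · obtain ⟨r, rfl⟩ : ∃ r, n = r + 1 := ⟨n - 1, by omega⟩
    obtain ⟨K, -, hK⟩ := exists_ncard_productTuples_le_of_det_ne_zero r k (half_pos hε)
    obtain ⟨H₀, hH₀, h⟩ := exists_forall_mul_rpow_le K ((k : ℝ) * (((r + 1 : ℕ) : ℝ) * r)) hε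
    refine ⟨H₀, fun H hH C hC => ((hK H (hH₀.trans hH) C hC).trans (h H hH)).trans_eq ?_⟩
    rw [hk]
    congr 2
    push_cast
    ring
  · obtain rfl : k = 1 := by omega
    obtain ⟨H₀, -, h⟩ := hall ε hε
    refine ⟨H₀, fun H hH C _ _ => (h H hH C).trans_eq ?_⟩
    norm_num
  · -- the general bound suffices: `k n² + 1 ≤ (k + 1) n² - n` because a nonzero singular matrix
    -- has size `n ≥ 2`
    obtain ⟨H₀, hH₀, h⟩ := hall 1 one_pos
    refine ⟨H₀, fun H hH C hC hC0 => (h H hH C).trans ?_⟩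
    have hn2 : 2 ≤ n := by
      by_contra hlt
      obtain rfl : n = 1 := by omega
      apply hC0
      ext i j
      rw [Subsingleton.elim i 0, Subsingleton.elim j 0]
      rwa [Matrix.det_fin_one] at hC
    have hn2' : (2 : ℝ) ≤ n := by exact_mod_cast hn2
    refine Real.rpow_le_rpow_of_exponent_le (by exact_mod_cast hH₀.trans hH) ?_
    push_cast
    nlinarith
  · rw [one_mul, hk]
    have := pow_le_ncard_productTuples_zero n k H
    have h2 : (H : ℝ) ^ ((k : ℝ) * (n : ℝ) ^ 2) = ((H ^ (k * n ^ 2) : ℕ) : ℝ) := by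
      rw [Nat.cast_pow, ← Real.rpow_natCast (H : ℝ) (k * n ^ 2), Nat.cast_mul, Nat.cast_pow]
    rw [h2]
    exact_mod_cast this
  · obtain ⟨H₀, -, h⟩ := hall ε hε
    rw [hk]
    exact ⟨H₀, fun H hH => h H hH 0⟩
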